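/- **Setting.** Let $n,k$ be positive integers with $n>3k$, let $\theta\in\mathbb Z$ be such that $T^n-\theta\in\mathbb Z[T]$ is irreducible, and let $K=\mathbb Q(\sqrt[n]{\theta})$, where $\sqrt[n]{\theta}$ is a root of $T^n-\theta$ and $\sqrt[n]{\theta^{i-1}}$ means $(\sqrt[n]{\theta})^{i-1}$. Let $N(\mathfrak d)$ be the norm of an integral ideal $\mathfrak d$ of $K$, and put $$\rho(\mathfrak d)=\frac{\#\{\mathbf x\in\mathbb Z^{n-k}\cap[1,N(\mathfrak d)]^{n-k}:\ \mathfrak d\mid(\sum_{i=1}^{n-k}x_i\sqrt[n]{\theta^{i-1}})\}}{N(\mathfrak d)^{n-k-1}} .$$ For $\mathbf t\in\mathbb R^{n-k}$ let $N_K(\mathbf t)=\prod_{\sigma:K\hookrightarrow\mathbb C}\sum_{i=1}^{n-k}t_i\,\sigma(\sqrt[n]{\theta})^{i-1}$ be the incomplete norm form. **Proposition (Type I estimate).** (1) For every $h\in\mathbb N$ and $\varepsilon>0$ there is a constant $C=C(n,k,\theta,h,\varepsilon)$ such that the following holds for all real $X\ge1$ and $D>0$, all integers $Q$ with $1\le Q\le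 X^{1/2}$, all $\mathbf x_0\in\mathbb Z^{n-k}$, and every measurable $\mathcal R\subseteq[-X,X]^{n-k}$ such that every line in $\mathbb R^{n-k}$ (in any direction) meets $\mathcal R$ in a union of at most $h$ intervals and such that $\mathcal R$ contains an axis-parallel hypercube of side length $X^{1-1/(2n)}$. Let $$\mathscr C=\Bigl\{\sum_{i=1}^{n-k}x_i\sqrt[n]{\theta^{i-1}}:\ \mathbf x\in\mathbb Z^{n-k}\cap\mathcal R,\ \mathbf x\equiv\mathbf x_0\ (\mathrm{mod}\ Q)\Bigr\},\qquad \mathscr C_{\mathfrak d}=\{c\in\mathscr C:\ \mathfrak d\mid(c)\}.$$ Then $$\sum_{\substack{N(\mathfrak d)\in[D,2D]\\ \gcd(N(\mathfrak d),Q)=1}}\Bigl|\#\mathscr C_{\mathfrak d}-\frac{\rho(\mathfrak d)\,\mathrm{vol}\,\mathcal R}{Q^{n-k}N(\mathfrak d)}\Bigr|\le C\bigl(X^{n-k-1}Q^{n+\varepsilon}D^{1/(n-k)+\varepsilon}+D\,Q^{n+\varepsilon}\bigr).$$ (2) For every $\varepsilon>0$ there is a constant $C=C(n,k,\theta,\varepsilon)$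 such that for every $\kappa>0$ there is an $X_0$ for which the following holds for all real $X\ge X_0$ and $D>0$, all $X_1,\dots,X_{n-k}\in[0,X]$ with $|N_K(X_1,\dots,X_{n-k})|\ge\kappa X^n$, all integers $q^*$ with $1\le q^*\le\exp((\log X)^{1/4})$ and all $\mathbf a_0\in\mathbb Z^{n-k}$. Let $\eta_1=(\log X)^{-100}$, let $\mathcal A$ be the set of principal ideals $(\sum_{i=1}^{n-k}a_i\sqrt[n]{\theta^{i-1}})$ with $\mathbf a\in\mathbb Z^{n-k}$, $a_i\in[X_i,X_i+\eta_1X_i]$ for all $i$ and $\mathbf a\equiv\mathbf a_0\ (\mathrm{mod}\ q^*)$, and let $\mathcal A_{\mathfrak d}=\{\mathfrak b:\ \mathfrak b\mathfrak d\in\mathcal A\}$. Then $$\sum_{\substack{N(\mathfrak d)\in[D,2D]\\ \gcd(N(\mathfrak d),q^*)=1}}\Bigl|\#\mathcal A_{\mathfrak d}-\frac{\rho(\mathfrak d)\,\#\mathcal A}{N(\mathfrak d)}\Bigr|\le C\bigl(X^{n-k-1+\varepsilon}D^{1/(n-k)+\varepsilon}+D\,X^{\varepsilon}\bigr).$$ 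-/

import Mathlib

open scoped NumberField

namespace IncompleteNorm

noncomputable section

/-- Every line of `ℝᵐ`, in whatever direction, meets `R` in a union of at most `h` intervals.
(An interval of `ℝ` is an order-connected set; it may be empty, a point, or unbounded.) -/
def LinesMeetInIntervals {m : ℕ} (h : ℕ) (R : Set (Fin m → ℝ)) : Prop :=
  ∀ a v : Fin m → ℝ, v ≠ 0 →
    ∃ I : Fin h → Set ℝ, (∀ j, (I j).OrdConnected) ∧ {t : ℝ | a + t • v ∈ R} = ⋃ j, I j

/-- `R` contains an axis-parallel cube of side length `s`. -/
def ContainsCube {m : ℕ} (s : ℝ) (R : Set (Fin m → ℝ)) : Prop :=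
  ∃ a : Fin m → ℝ, Set.Icc a (fun i => a i + s) ⊆ R

variable {K : Type*} [Field K] [NumberField K]

/-- The algebraic integer `∑_{i=1}^{m} x_i α^{i-1}`. -/
def elt {m : ℕ} (α : 𝓞 K) (x : Fin m → ℤ) : 𝓞 K :=
  ∑ i, (x i : 𝓞 K) * α ^ (i : ℕ)

/-- The elements `∑ x_i α^{i-1}` with `x` an integer vector in `R` and `x ≡ x₀ (mod Q)`. -/
def eltSet {m : ℕ} (α : 𝓞 K) (R : Set (Fin m → ℝ)) (Q : ℕ) (x₀ : Fin m → ℤ) : Set (𝓞 K) :=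
  {c | ∃ x : Fin m → ℤ, (fun i => (x i : ℝ)) ∈ R ∧ (∀ i, x i ≡ x₀ i [ZMOD (Q : ℤ)]) ∧
    elt α x = c}

/-- The elements of `C` that generate an ideal which is a multiple of `𝔡`. -/
def multiplesIn (C : Set (𝓞 K)) (𝔡 : Ideal (𝓞 K)) : Set (𝓞 K) :=
  {c ∈ C | 𝔡 ∣ Ideal.span {c}}

/-- For a set `A` of ideals, `A_𝔡 = {𝔟 : 𝔟𝔡 ∈ A}`. -/
def quotientsIn (A : Set (Ideal (𝓞 K))) (𝔡 : Ideal (𝓞 K)) : Set (Ideal (𝓞 K)) :=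
  {𝔟 | 𝔟 * 𝔡 ∈ A}

/-- `ρ(𝔡) = #{x ∈ [1, N(𝔡)]^m : 𝔡 ∣ (∑ x_i α^{i-1})} / N(𝔡)^{m-1}`. -/
def rho (m : ℕ) (α : 𝓞 K) (𝔡 : Ideal (𝓞 K)) : ℝ :=
  ({x : Fin m → ℤ | (∀ i, 1 ≤ x i ∧ x i ≤ (Ideal.absNorm 𝔡 : ℤ)) ∧
      𝔡 ∣ Ideal.span {elt α x}}.ncard : ℝ) / (Ideal.absNorm 𝔡 : ℝ) ^ (m - 1)

theorem finite_idealsBetween (K : Type*) [Field K] [NumberField K] (D : ℝ) (Q : ℕ) :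
    {𝔡 : Ideal (𝓞 K) | D ≤ (Ideal.absNorm 𝔡 : ℝ) ∧ (Ideal.absNorm 𝔡 : ℝ) ≤ 2 * D ∧
      Nat.Coprime (Ideal.absNorm 𝔡) Q}.Finite :=
  (Ideal.finite_setOfPred_absNorm_le (S := 𝓞 K) ⌊2 * D⌋₊).subset
    fun _ h => Nat.le_floor h.2.1

/-- The finite set of integral ideals `𝔡` of `K` with `N(𝔡) ∈ [D, 2D]` and `gcd(N(𝔡), Q) = 1`. -/
def idealsBetween (K : Type*) [Field K] [NumberField K] (D : ℝ) (Q : ℕ) :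
    Finset (Ideal (𝓞 K)) :=
  (finite_idealsBetween K D Q).toFinset

/-- The incomplete norm form `N_K(t)` at a real vector `t`, as the product of the linear forms
`∑ t_i σ(α)^{i-1}` over the embeddings `σ : K → ℂ`. -/
def normForm {m : ℕ} (α : 𝓞 K) (t : Fin m → ℝ) : ℂ :=
  ∏ σ : K →+* ℂ, ∑ i, (t i : ℂ) * σ (α : K) ^ (i : ℕ)

/-- On integer vectors the norm form is the field norm of `∑ x_i α^{i-1}`. -/
theorem normForm_intCast {m : ℕ} (α : 𝓞 K) (x : Fin m → ℤ) :
    normForm α (fun i => (x i : ℝ)) = ((Algebra.norm ℚ (elt α x : K) : ℚ) : ℂ) := by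
  have h := Algebra.norm_eq_prod_embeddings ℚ ℂ (elt α x : K)
  rw [eq_ratCast] at h
  rw [h, normForm]
  refine Fintype.prod_equiv (RingHom.equivRatAlgHom K ℂ) _ _ fun σ => ?_
  simp [elt]

/-- The set of principal ideals `(∑ a_i α^{i-1})` with `a` an integer vector,
`a_i ∈ [Y_i, Y_i + η Y_i]` and `a ≡ a₀ (mod q)`. -/
def boxIdeals {m : ℕ} (α : 𝓞 K) (Y : Fin m → ℝ) (η : ℝ) (q : ℕ) (a₀ : Fin m → ℤ) :
    Set (Ideal (𝓞 K)) :=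
  (fun c => Ideal.span {c}) '' eltSet α (Set.Icc Y (fun i => Y i + η * Y i)) q a₀

end

end IncompleteNorm

/-! ### Integer points in sets that meet lines in few intervals. -/

namespace IncompleteNorm

open MeasureTheory

/-! Put `m = n - k`. The vectors `x` with `𝔡 ∣ (∑ x_i α^{i-1})` form a subgroup of `ℤᵐ`
(`coeffLattice`) that contains `N(𝔡) ℤᵐ`, and `ρ(𝔡)/N(𝔡)` is the reciprocal of its index
(`rho_div_absNorm`). Since `N(𝔡)` is coprime to `Q`, imposing the congruence mod `Q` cuts out a
coset of `Q` times this lattice. A reduced basis (`exists_reduced_basis`) carries the coset to `ℤᵐ`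
and `R` into a cube of side `≪ X/(Q l)`, where `l` is the sup norm of a shortest nonzero vector of
the lattice. Lines go to lines, in new directions, so the interval property survives, and counting
by slices (`LinesMeetInIntervals.abs_ncard_sub_volume_le`) gives an error `≪ 1 + (X/l)^{m-1}`.

Summed over `𝔡`, the term `1` contributes `O(D)`. The average of `l^{-(m-1)}` is bounded in
`exists_sum_minAbs_le`. Pigeonhole gives `l ≤ (2D)^{1/m}`. Each `𝔡` divides `(∑ x_i α^{i-1})` for a
shortest vector `x` of its lattice, and by the divisor bound a given `x` serves `≪ |x|^δ` ideals.
The `≪ r^{m-1}` vectors of norm `r` cancel the weight `r^{-(m-1)}`, so the sum over `r ≤ (2D)^{1/m}`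
is `≪ D^{1/m+ε}`.

For (2), when `X` is large the elements of the box generate distinct ideals
(`exists_injOn_span_eltSet`), so `#𝒜_𝔡` counts elements divisible by `𝔡`. The argument of (1)
applies to the box, and the count for `𝔡 = (1)` replaces the volume by `#𝒜`. -/

/-- A bounded interval contains as many integers as its length, up to an error of one. -/
theorem abs_ncard_int_sub_volume_le_one {I : Set ℝ} (hI : I.OrdConnected)
    (hb : Bornology.IsBounded I) :
    |({z : ℤ | (z : ℝ) ∈ I}.ncard : ℝ) - volume.real I| ≤ 1 := by
  rcases I.eq_empty_or_nonempty with rfl | hne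
  · simp
  set a := sInf I
  set b := sSup I
  have hba := hb.bddAbove
  have hbb := hb.bddBelow
  have hab : a ≤ b := Real.sInf_le_sSup I hbb hba
  have hsub : I ⊆ Set.Icc a b := fun x hx => ⟨csInf_le hbb hx, le_csSup hba hx⟩
  have hsup : Set.Ioo a b ⊆ I := by
    intro x hx
    obtain ⟨y, hy, hyx⟩ := exists_lt_of_csInf_lt hne hx.1
    obtain ⟨z, hz, hxz⟩ := exists_lt_of_lt_csSup hne hx.2
    exact hI.out hy hz ⟨hyx.le, hxz.le⟩
  have hvol : volume.real I = b - a := by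
    apply le_antisymm
    · refine (measureReal_mono hsub (by simp)).trans ?_
      rw [Real.volume_real_Icc_of_le hab]
    · rw [← Real.volume_real_Ioo_of_le hab]
      exact measureReal_mono hsup ((measure_mono hsub).trans_lt (by simp)).ne
  have h1 : {z : ℤ | (z : ℝ) ∈ I} ⊆ ↑(Finset.Icc ⌈a⌉ ⌊b⌋) := by
    intro z hz
    have := hsub hz
    simpa [Int.ceil_le, Int.le_floor] using this
  have h2 : ↑(Finset.Ioo ⌊a⌋ ⌈b⌉) ⊆ {z : ℤ | (z : ℝ) ∈ I} := by
    intro z hz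
    apply hsup
    simpa [Int.floor_lt, Int.lt_ceil] using hz
  have hfin : {z : ℤ | (z : ℝ) ∈ I}.Finite := (Finset.finite_toSet _).subset h1
  have c1 := Set.ncard_le_ncard h1 (Finset.finite_toSet _)
  have c2 := Set.ncard_le_ncard h2 hfin
  rw [Set.ncard_coe_finset, Int.card_Icc] at c1
  rw [Set.ncard_coe_finset, Int.card_Ioo] at c2
  have f1 := Int.floor_le b
  have f2 := Int.le_ceil a
  have f3 := Int.floor_le a
  have f4 := Int.le_ceil b
  have f5 := Int.lt_floor_add_one b
  have f6 := Int.ceil_lt_add_one a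
  have c1' : ({z : ℤ | (z : ℝ) ∈ I}.ncard : ℝ) ≤ b - a + 1 := by
    have : ({z : ℤ | (z : ℝ) ∈ I}.ncard : ℝ) ≤ (((⌊b⌋ + 1 - ⌈a⌉).toNat : ℤ) : ℝ) := by
      exact_mod_cast c1
    refine this.trans ?_
    rw [Int.toNat_eq_max]
    push_cast
    apply max_le <;> linarith
  have c2' : b - a - 1 ≤ ({z : ℤ | (z : ℝ) ∈ I}.ncard : ℝ) := by
    have : (((⌈b⌉ - ⌊a⌋ - 1).toNat : ℤ) : ℝ) ≤ ({z : ℤ | (z : ℝ) ∈ I}.ncard : ℝ) := by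
      exact_mod_cast c2
    refine le_trans ?_ this
    rw [Int.toNat_eq_max]
    push_cast
    refine le_trans ?_ (le_max_left _ _)
    linarith
  rw [hvol, abs_le]
  constructor <;> linarith

theorem finite_int_of_isBounded {S : Set ℝ} (hb : Bornology.IsBounded S) :
    {z : ℤ | (z : ℝ) ∈ S}.Finite := by
  refine (Finset.finite_toSet (Finset.Icc ⌈sInf S⌉ ⌊sSup S⌋)).subset fun z hz => ?_
  have : (z : ℝ) ∈ Set.Icc (sInf S) (sSup S) := ⟨csInf_le hb.bddBelow hz, le_csSup hb.bddAbove hz⟩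
  simpa [Int.ceil_le, Int.le_floor] using this

/-- A bounded union of `h` intervals contains as many integers as its length,
up to a bounded error. -/
theorem abs_ncard_int_iUnion_sub_volume_le (h : ℕ) (I : Fin h → Set ℝ)
    (hI : ∀ j, (I j).OrdConnected) (hb : Bornology.IsBounded (⋃ j, I j)) :
    |({z : ℤ | (z : ℝ) ∈ ⋃ j, I j}.ncard : ℝ) - volume.real (⋃ j, I j)| ≤ 2 ^ h - 1 := by
  induction h with
  | zero => simp
  | succ h ih =>
    have hU : (⋃ j, I j) = (⋃ j : Fin h, I j.succ) ∪ I 0 := by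
      ext x
      simp [Fin.exists_fin_succ, or_comm]
    have hN : (⋃ j : Fin h, I j.succ) ∩ I 0 = ⋃ j : Fin h, (I j.succ ∩ I 0) := Set.iUnion_inter _ _
    set S := ⋃ j : Fin h, I j.succ with hS
    rw [hU] at hb ⊢
    have hbS : Bornology.IsBounded S := hb.subset Set.subset_union_left
    have hb0 : Bornology.IsBounded (I 0) := hb.subset Set.subset_union_right
    have hbN : Bornology.IsBounded (S ∩ I 0) := hb0.subset Set.inter_subset_right
    have e1 := ih (fun j => I j.succ) (fun j => hI _) hbS
    -- The intervals may overlap. In inclusion–exclusion the intersection is again a union of `h`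
    -- intervals, so the error doubles and gains one, which gives `2 ^ h - 1`.
    have e2 := ih (fun j => I j.succ ∩ I 0) (fun j => (hI _).inter (hI _)) (hN ▸ hbN)
    rw [← hN] at e2
    have e3 := abs_ncard_int_sub_volume_le_one (hI 0) hb0
    have m1 : volume.real (S ∪ I 0) + volume.real (S ∩ I 0) = volume.real S + volume.real (I 0) :=
      measureReal_union_add_inter (hI 0).measurableSet hbS.measure_lt_top.ne hb0.measure_lt_top.ne
    have m2 : {z : ℤ | (z : ℝ) ∈ S ∪ I 0}.ncard + {z : ℤ | (z : ℝ) ∈ S ∩ I 0}.ncard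
        = {z : ℤ | (z : ℝ) ∈ S}.ncard + {z : ℤ | (z : ℝ) ∈ I 0}.ncard :=
      Set.ncard_union_add_ncard_inter {z : ℤ | (z : ℝ) ∈ S} {z : ℤ | (z : ℝ) ∈ I 0}
        (finite_int_of_isBounded hbS) (finite_int_of_isBounded hb0)
    have m2' : ({z : ℤ | (z : ℝ) ∈ S ∪ I 0}.ncard : ℝ) + ({z : ℤ | (z : ℝ) ∈ S ∩ I 0}.ncard : ℝ)
        = ({z : ℤ | (z : ℝ) ∈ S}.ncard : ℝ) + ({z : ℤ | (z : ℝ) ∈ I 0}.ncard : ℝ) := by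
      exact_mod_cast m2
    rw [abs_le] at e1 e2 e3 ⊢
    rw [pow_succ]
    constructor <;> linarith [e1.1, e1.2, e2.1, e2.2, e3.1, e3.2]

theorem card_piFinset_Icc_le {m : ℕ} (a : Fin m → ℝ) {L : ℝ} (hL : 0 ≤ L) :
    ((Fintype.piFinset fun i => Finset.Icc ⌈a i⌉ ⌊a i + L⌋).card : ℝ) ≤ (L + 1) ^ m := by
  rw [Fintype.card_piFinset]
  push_cast
  refine (Finset.prod_le_prod (fun _ _ => by positivity) (fun i _ => ?_)).trans
    (b := ∏ _i : Fin m, (L + 1)) (by simp)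
  rw [Int.card_Icc]
  have : (((⌊a i + L⌋ + 1 - ⌈a i⌉).toNat : ℤ) : ℝ) ≤ L + 1 := by
    rw [Int.toNat_eq_max]
    push_cast
    apply max_le
    · linarith [Int.floor_le (a i + L), Int.le_ceil (a i)]
    · linarith
  exact_mod_cast this

theorem mem_piFinset_Icc_of_mem {m : ℕ} {a : Fin m → ℝ} {L : ℝ} {x : Fin m → ℤ}
    (hx : (fun i => (x i : ℝ)) ∈ Set.Icc a fun i => a i + L) :
    x ∈ Fintype.piFinset fun i => Finset.Icc ⌈a i⌉ ⌊a i + L⌋ := by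
  rw [Fintype.mem_piFinset]
  intro i
  rw [Finset.mem_Icc, Int.ceil_le, Int.le_floor]
  exact ⟨hx.1 i, hx.2 i⟩

theorem finite_int_of_subset_Icc {m : ℕ} {R : Set (Fin m → ℝ)} {a b : Fin m → ℝ}
    (hR : R ⊆ Set.Icc a b) : {x : Fin m → ℤ | (fun i => (x i : ℝ)) ∈ R}.Finite := by
  refine (Set.finite_Icc (fun i => ⌈a i⌉) (fun i => ⌊b i⌋)).subset fun x hx => ?_
  exact ⟨fun i => Int.ceil_le.2 ((hR hx).1 i), fun i => Int.le_floor.2 ((hR hx).2 i)⟩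

/-- A slice of a set that meets lines in few intervals has the same property. -/
theorem LinesMeetInIntervals.slice {m h : ℕ} {R : Set (Fin (m + 1) → ℝ)}
    (hR : LinesMeetInIntervals h R) (t : ℝ) :
    LinesMeetInIntervals h {y : Fin m → ℝ | (Fin.cons t y : Fin (m + 1) → ℝ) ∈ R} := by
  intro a v hv
  obtain ⟨I, hI, hU⟩ := hR (Fin.cons t a) (Fin.cons 0 v) (fun h0 => hv (funext fun i => by
    simpa using congrFun h0 i.succ))
  refine ⟨I, hI, ?_⟩
  rw [← hU]
  ext s
  have : (Fin.cons t (a + s • v) : Fin (m + 1) → ℝ) = Fin.cons t a + s • Fin.cons 0 v := by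
    ext i
    refine Fin.cases ?_ (fun j => ?_) i <;> simp
  simp only [Set.mem_ofPred_eq, this]

/-- Number of integer points versus volume for the fibres in the first coordinate. -/
theorem LinesMeetInIntervals.abs_ncard_fiber_sub_le {m h : ℕ} {R : Set (Fin (m + 1) → ℝ)}
    (hR : LinesMeetInIntervals h R) {a b : Fin (m + 1) → ℝ} (hb : R ⊆ Set.Icc a b)
    (y : Fin m → ℝ) :
    |({z : ℤ | (Fin.cons (z : ℝ) y : Fin (m + 1) → ℝ) ∈ R}.ncard : ℝ)
      - volume.real {t : ℝ | (Fin.cons t y : Fin (m + 1) → ℝ) ∈ R}| ≤ 2 ^ h := by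
  obtain ⟨I, hI, hU⟩ := hR (Fin.cons 0 y) (Fin.cons 1 0) (fun h0 => by
    simpa using congrFun h0 0)
  have hU' : {t : ℝ | (Fin.cons t y : Fin (m + 1) → ℝ) ∈ R} = ⋃ j, I j := by
    rw [← hU]
    ext s
    have : (Fin.cons s y : Fin (m + 1) → ℝ) = Fin.cons 0 y + s • Fin.cons 1 0 := by
      ext i
      refine Fin.cases ?_ (fun j => ?_) i <;> simp
    simp only [Set.mem_ofPred_eq, this]
  have hbd : Bornology.IsBounded (⋃ j, I j) := by
    rw [← hU']
    refine (Metric.isBounded_Icc (a 0) (b 0)).subset fun t ht => ?_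
    simpa using And.intro ((hb ht).1 0) ((hb ht).2 0)
  have := abs_ncard_int_iUnion_sub_volume_le h I hI hbd
  rw [← hU'] at this
  exact this.trans (by linarith)

/-- Davenport's slicing argument. Between the count and the volume stands a mixed quantity, discrete
in the last coordinates and continuous in the first: the sum over integer `y` of the length of the
fibre `F y`, equal to the integral over `t` of the number of integer points of the slice `S t`. The
count differs from it by `2 ^ h` for each of at most `(L + 1) ^ m` fibres; the volume differs from
it by the inductive error integrated over an interval of length `L`. -/
theorem LinesMeetInIntervals.abs_ncard_sub_volume_le {m h : ℕ} {R : Set (Fin m → ℝ)}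
    (hR : LinesMeetInIntervals h R) (hm : MeasurableSet R) {a : Fin m → ℝ} {L : ℝ} (hL : 0 ≤ L)
    (hb : R ⊆ Set.Icc a fun i => a i + L) :
    |({x : Fin m → ℤ | (fun i => (x i : ℝ)) ∈ R}.ncard : ℝ) - volume.real R|
      ≤ 2 ^ h * m * (L + 1) ^ (m - 1) := by
  induction m with
  | zero =>
    rcases Set.eq_empty_or_nonempty R with rfl | ⟨x, hx⟩
    · simp
    · have : R = Set.univ := by
        ext y
        simp [Subsingleton.elim y x, hx]
      subst this
      simp [volume_pi, measureReal_def]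
  | succ m ih =>
    classical
    set e := (MeasurableEquiv.piFinSuccAbove (fun _ : Fin (m + 1) => ℝ) 0).symm with he
    have hecons : ∀ p : ℝ × (Fin m → ℝ), e p = Fin.cons p.1 p.2 := fun p => by
      ext i
      refine Fin.cases ?_ (fun j => ?_) i <;> simp [e, MeasurableEquiv.piFinSuccAbove]
    have hmp : MeasurePreserving e (volume.prod volume) volume :=
      (volume_preserving_piFinSuccAbove (fun _ : Fin (m + 1) => ℝ) 0).symm
    set R' : Set (ℝ × (Fin m → ℝ)) := {p | (Fin.cons p.1 p.2 : Fin (m + 1) → ℝ) ∈ R} with hR'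
    have hR'e : R' = e ⁻¹' R := by
      ext p
      simp [hR', hecons]
    have hR'm : MeasurableSet R' := hR'e ▸ e.measurable hm
    have hvol : (volume.prod volume) R' = volume R := by
      rw [hR'e, hmp.measure_preimage_equiv]
    have hRfin : volume R ≠ ⊤ := ((measure_mono hb).trans_lt (isCompact_Icc.measure_lt_top)).ne
    have hint : Integrable (R'.indicator (fun _ => (1 : ℝ))) (volume.prod volume) := by
      rw [integrable_indicator_iff hR'm]
      exact integrableOn_const (hvol ▸ hRfin)
    set S : ℝ → Set (Fin m → ℝ) := fun t => {y | (Fin.cons t y : Fin (m + 1) → ℝ) ∈ R} with hS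
    set F : (Fin m → ℝ) → Set ℝ := fun y => {t | (Fin.cons t y : Fin (m + 1) → ℝ) ∈ R} with hF
    have hSm : ∀ t, MeasurableSet (S t) := fun t => measurable_prodMk_left hR'm
    have hFm : ∀ y, MeasurableSet (F y) := fun y => measurable_prodMk_right hR'm
    have hinner : ∀ t, ∫ y, R'.indicator (fun _ => (1 : ℝ)) (t, y) = volume.real (S t) := by
      intro t
      rw [← integral_indicator_one (hSm t)]
      rfl
    have hvolint : volume.real R = ∫ t, volume.real (S t) := by
      rw [measureReal_def, ← hvol, ← measureReal_def, ← integral_indicator_one hR'm]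
      refine (integral_prod _ hint).trans ?_
      exact integral_congr_ae (Filter.Eventually.of_forall hinner)
    have hSint : Integrable fun t => volume.real (S t) := by
      have := hint.integral_prod_left
      simpa only [hinner] using this
    have hSbox : ∀ t, S t ⊆ Set.Icc (fun i : Fin m => a i.succ) (fun i => a i.succ + L) :=
      fun t y hy => ⟨fun i => by simpa using (hb hy).1 i.succ, fun i => by
        simpa using (hb hy).2 i.succ⟩
    have hFbox : ∀ y, F y ⊆ Set.Icc (a 0) (a 0 + L) :=
      fun y t ht => by simpa using And.intro ((hb ht).1 0) ((hb ht).2 0)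
    have hFfin : ∀ y, volume (F y) ≠ ⊤ := fun y =>
      ((measure_mono (hFbox y)).trans_lt isCompact_Icc.measure_lt_top).ne
    set Y : Finset (Fin m → ℤ) := Fintype.piFinset fun i => Finset.Icc ⌈a i.succ⌉ ⌊a i.succ + L⌋
      with hY
    have hYcard : (Y.card : ℝ) ≤ (L + 1) ^ m := card_piFinset_Icc_le (fun i => a i.succ) hL
    set T : Set (Fin (m + 1) → ℤ) := {x | (fun i => (x i : ℝ)) ∈ R} with hT
    have hTfin : T.Finite := finite_int_of_subset_Icc hb
    have hcast : ∀ (z : ℤ) (y : Fin m → ℤ), (fun i => ((Fin.cons z y : Fin (m + 1) → ℤ) i : ℝ))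
        = Fin.cons (z : ℝ) (fun i => (y i : ℝ)) := by
      intro z y
      ext i
      refine Fin.cases ?_ (fun j => ?_) i <;> simp
    have hcount : T.ncard = ∑ y ∈ Y, {z : ℤ | (z : ℝ) ∈ F (fun i => (y i : ℝ))}.ncard := by
      rw [Set.ncard_eq_toFinset_card T hTfin,
        Finset.card_eq_sum_card_fiberwise (f := Fin.tail) (t := Y)]
      · refine Finset.sum_congr rfl fun y _ => ?_
        rw [← Set.ncard_coe_finset]
        refine Set.ncard_congr (fun x _ => x 0) ?_ ?_ ?_
        · intro x hx
          simp only [Finset.coe_filter, Set.Finite.mem_toFinset, Set.mem_ofPred_eq] at hx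
          obtain ⟨hx, rfl⟩ := hx
          show Fin.cons _ _ ∈ R
          rw [← hcast, Fin.cons_self_tail]
          exact hx
        · intro x x' hx hx' h0
          simp only [Finset.coe_filter, Set.mem_ofPred_eq] at hx hx'
          rw [← Fin.cons_self_tail x, ← Fin.cons_self_tail x', hx.2, hx'.2, h0]
        · intro z hz
          refine ⟨Fin.cons z y, ?_, by simp⟩
          simp only [Finset.coe_filter, Set.Finite.mem_toFinset, Set.mem_ofPred_eq, Fin.tail_cons,
            and_true]
          show _ ∈ R
          rw [hcast]
          exact hz
      · intro x hx
        rw [Finset.mem_coe, Set.Finite.mem_toFinset] at hx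
        exact mem_piFinset_Icc_of_mem (a := fun i => a i.succ)
          ⟨fun i => (hb hx).1 i.succ, fun i => (hb hx).2 i.succ⟩
    have hsum : ∑ y ∈ Y, volume.real (F (fun i => (y i : ℝ)))
        = ∫ t, ({y : Fin m → ℤ | (fun i => (y i : ℝ)) ∈ S t}.ncard : ℝ) := by
      have h1 : ∀ y : Fin m → ℤ, volume.real (F (fun i => (y i : ℝ)))
          = ∫ t, (F (fun i => (y i : ℝ))).indicator (1 : ℝ → ℝ) t := fun y =>
        (integral_indicator_one (hFm _)).symm
      simp_rw [h1]
      rw [← integral_finsetSum]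
      · refine integral_congr_ae (Filter.Eventually.of_forall fun t => ?_)
        have : {y : Fin m → ℤ | (fun i => (y i : ℝ)) ∈ S t}
            = ↑(Y.filter fun y => t ∈ F (fun i => (y i : ℝ))) := by
          ext y
          simp only [Set.mem_ofPred_eq, Finset.coe_filter]
          exact ⟨fun hy => ⟨mem_piFinset_Icc_of_mem (hSbox t hy), hy⟩, fun hy => hy.2⟩
        simp only [this, Set.ncard_coe_finset, Finset.card_filter, Set.indicator_apply]
        push_cast
        rfl
      · intro y _
        exact (integrable_indicator_iff (hFm _)).2 (integrableOn_const (hFfin _))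
    have hNint : Integrable fun t => ({y : Fin m → ℤ | (fun i => (y i : ℝ)) ∈ S t}.ncard : ℝ) := by
      have h1 : Integrable fun t => ∑ y ∈ Y, (F (fun i => (y i : ℝ))).indicator (1 : ℝ → ℝ) t :=
        integrable_finsetSum _ fun y _ =>
          (integrable_indicator_iff (hFm _)).2 (integrableOn_const (hFfin _))
      refine h1.congr (Filter.Eventually.of_forall fun t => ?_)
      have : {y : Fin m → ℤ | (fun i => (y i : ℝ)) ∈ S t}
          = ↑(Y.filter fun y => t ∈ F (fun i => (y i : ℝ))) := by
        ext y
        simp only [Set.mem_ofPred_eq, Finset.coe_filter]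
        exact ⟨fun hy => ⟨mem_piFinset_Icc_of_mem (hSbox t hy), hy⟩, fun hy => hy.2⟩
      simp only [this, Set.ncard_coe_finset, Finset.card_filter, Set.indicator_apply]
      push_cast
      rfl
    have hE1 : |(T.ncard : ℝ) - ∑ y ∈ Y, volume.real (F (fun i => (y i : ℝ)))|
        ≤ (L + 1) ^ m * 2 ^ h := by
      rw [hcount]
      push_cast
      rw [← Finset.sum_sub_distrib]
      refine (Finset.abs_sum_le_sum_abs _ _).trans ?_
      refine (Finset.sum_le_card_nsmul _ _ _ fun y _ => hR.abs_ncard_fiber_sub_le hb _).trans ?_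
      rw [nsmul_eq_mul]
      gcongr
    have hE2 : |(∑ y ∈ Y, volume.real (F (fun i => (y i : ℝ)))) - volume.real R|
        ≤ 2 ^ h * m * (L + 1) ^ (m - 1) * L := by
      rw [hsum, hvolint, ← integral_sub hNint hSint,
        ← setIntegral_eq_integral_of_forall_compl_eq_zero (s := Set.Icc (a 0) (a 0 + L))]
      · have hle : ∀ t ∈ Set.Icc (a 0) (a 0 + L),
            ‖({y : Fin m → ℤ | (fun i => (y i : ℝ)) ∈ S t}.ncard : ℝ) - volume.real (S t)‖
              ≤ 2 ^ h * m * (L + 1) ^ (m - 1) := fun t _ => by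
          rw [Real.norm_eq_abs]
          exact ih (hR.slice t) (hSm t) (hSbox t)
        have := norm_setIntegral_le_of_norm_le_const (μ := (volume : Measure ℝ))
          isCompact_Icc.measure_lt_top hle
        rw [← Real.norm_eq_abs]
        refine this.trans ?_
        rw [Real.volume_real_Icc_of_le (by linarith)]
        simp
      · intro t ht
        have : S t = ∅ := by
          ext y
          simp only [Set.mem_empty_iff_false, iff_false]
          intro hy
          exact ht (hFbox y hy)
        simp [this]
    have hL1 : (1 : ℝ) ≤ L + 1 := by linarith
    calc _ ≤ (L + 1) ^ m * 2 ^ h + 2 ^ h * m * (L + 1) ^ (m - 1) * L := by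
          have := abs_sub_le (T.ncard : ℝ) (∑ y ∈ Y, volume.real (F (fun i => (y i : ℝ))))
            (volume.real R)
          linarith
      _ ≤ (L + 1) ^ m * 2 ^ h + 2 ^ h * (m * (L + 1) ^ m) := by
          have : (m : ℝ) * (L + 1) ^ (m - 1) * L ≤ m * (L + 1) ^ m := by
            rcases m with _ | m
            · simp
            · rw [Nat.add_sub_cancel, pow_succ, mul_assoc]
              gcongr
              linarith
          have h2 : (0 : ℝ) < 2 ^ h := by positivity
          nlinarith
      _ = _ := by
          push_cast
          ring

end IncompleteNorm

/-! ### Reduced generators of discrete subgroups. -/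

namespace IncompleteNorm

open MeasureTheory

/-- In a subgroup of an inner product space whose nonzero vectors have length at least `l`, there
is a family of generators all of whose coordinates are controlled by the length of a vector. -/
theorem exists_reduced_generators (E : Type*) [NormedAddCommGroup E] [InnerProductSpace ℝ E]
    [FiniteDimensional ℝ E] (d : ℕ) :
    ∃ c : ℝ, 0 < c ∧ ∀ (L : AddSubgroup E) (l : ℝ), 0 < l →
      Module.finrank ℝ (Submodule.span ℝ (L : Set E)) ≤ d → (∀ x ∈ L, x ≠ 0 → l ≤ ‖x‖) →
      ∃ r ≤ d, ∃ b : Fin r → E, (∀ i, b i ∈ L) ∧ (∀ x ∈ L, ∃ z : Fin r → ℤ, x = ∑ i, z i • b i) ∧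
        ∀ (t : Fin r → ℝ) (i : Fin r), c * l * |t i| ≤ ‖∑ j, t j • b j‖ := by
  induction d with
  | zero =>
    refine ⟨1, one_pos, fun L l hl hd hmin => ⟨0, le_rfl, Fin.elim0, fun i => i.elim0, ?_,
      fun _ i => i.elim0⟩⟩
    intro x hx
    have h0 : Submodule.span ℝ (L : Set E) = ⊥ := by
      rw [← Submodule.finrank_eq_zero (R := ℝ)]
      omega
    have : x ∈ Submodule.span ℝ (L : Set E) := Submodule.subset_span hx
    rw [h0, Submodule.mem_bot] at this
    exact ⟨0, by simp [this]⟩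
  | succ d ih =>
    obtain ⟨c, hc, ih⟩ := ih
    -- `c / 2` serves the old coordinates, since projection may halve the minimal length; `(1 + d /
    -- c)⁻¹` serves the coordinate along the new vector.
    refine ⟨min (c / 2) (1 + d / c)⁻¹, by positivity, fun L l hl hd hmin => ?_⟩
    by_cases hL : ∀ x ∈ L, x = 0
    · refine ⟨0, Nat.zero_le _, Fin.elim0, fun i => i.elim0, ?_, fun _ i => i.elim0⟩
      intro x hx
      exact ⟨0, by simp [hL x hx]⟩
    push Not at hL
    -- A nearly shortest vector is enough, so the infimum need not be attained. The factor `10 / 11`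
    -- works because `(10 / 11) ^ 2 > 1 / 2`.
    obtain ⟨v, hvL, hv0, hvmin⟩ : ∃ v ∈ L, v ≠ 0 ∧ ∀ y ∈ L, y ≠ 0 → 10 / 11 * ‖v‖ ≤ ‖y‖ := by
      set N : Set ℝ := (fun x => ‖x‖) '' {x | x ∈ L ∧ x ≠ 0}
      have hNne : N.Nonempty := by
        obtain ⟨x, hx, hx0⟩ := hL
        exact ⟨_, x, ⟨hx, hx0⟩, rfl⟩
      have hlow : ∀ y ∈ N, l ≤ y := by
        rintro _ ⟨x, hx, rfl⟩
        exact hmin x hx.1 hx.2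
      have hbdd : BddBelow N := ⟨l, hlow⟩
      have hinf : l ≤ sInf N := le_csInf hNne hlow
      obtain ⟨_, ⟨v, hv, rfl⟩, hlt⟩ := exists_lt_of_csInf_lt hNne
        (show sInf N < 11 / 10 * sInf N by linarith)
      refine ⟨v, hv.1, hv.2, fun y hy hy0 => ?_⟩
      have : sInf N ≤ ‖y‖ := csInf_le hbdd ⟨y, ⟨hy, hy0⟩, rfl⟩
      simp only at hlt
      linarith
    have hvpos : 0 < ‖v‖ := norm_pos_iff.2 hv0
    have hlv : l ≤ ‖v‖ := hmin v hvL hv0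
    -- `μ` is the coordinate along `v` and `p` the orthogonal projection off `v`; the induction is
    -- applied to `p(L)`.
    set μ : E →ₗ[ℝ] ℝ := (‖v‖ ^ 2)⁻¹ • (innerₛₗ ℝ v) with hμ
    have hμv : μ v = 1 := by
      simp only [hμ, LinearMap.smul_apply, innerₛₗ_apply_apply, real_inner_self_eq_norm_sq, smul_eq_mul]
      field_simp
    set p : E →ₗ[ℝ] E := LinearMap.id - μ.smulRight v with hp
    have hpx : ∀ x, p x = x - μ x • v := fun x => by simp [hp]
    have hpv : p v = 0 := by simp [hpx, hμv]
    have horth : ∀ x, inner ℝ v (p x) = 0 := by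
      intro x
      simp only [hpx, hμ, inner_sub_right, inner_smul_right, real_inner_self_eq_norm_sq,
        LinearMap.smul_apply, innerₛₗ_apply_apply, smul_eq_mul]
      field_simp
      ring
    have hpyth : ∀ x, ‖x‖ ^ 2 = ‖p x‖ ^ 2 + μ x ^ 2 * ‖v‖ ^ 2 := by
      intro x
      have hx : x = p x + μ x • v := by rw [hpx]; abel
      have h1 : inner ℝ (p x) (μ x • v) = 0 := by
        rw [inner_smul_right, real_inner_comm, horth, mul_zero]
      conv_lhs => rw [hx]
      rw [norm_add_sq_real, h1, norm_smul, mul_pow, Real.norm_eq_abs, sq_abs]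
      ring
    have hround : ∀ x ∈ L, ∃ y ∈ L, ∃ n : ℤ, y = x - n • v ∧ p y = p x ∧ |μ y| ≤ 1 / 2 := by
      intro x hx
      refine ⟨x - round (μ x) • v, L.sub_mem hx (L.zsmul_mem hvL _), _, rfl, ?_, ?_⟩
      · rw [map_sub, map_zsmul, hpv, smul_zero, sub_zero]
      · rw [map_sub, map_zsmul, hμv, zsmul_one]
        exact abs_sub_round _
    -- Lift a projected vector with `|μ| ≤ 1 / 2`. If the projection were shorter than `l / 2 ≤ ‖v‖
    -- / 2`, the lift would have squared length below `‖v‖ ^ 2 / 2`, against the choice of `v`.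
    have hpmin : ∀ x ∈ L.map p.toAddMonoidHom, x ≠ 0 → l / 2 ≤ ‖x‖ := by
      rintro _ ⟨x, hx, rfl⟩ hx0
      obtain ⟨y, hy, n, -, hpy, hμy⟩ := hround x hx
      have hx0' : p x ≠ 0 := hx0
      have hy0 : y ≠ 0 := by
        rintro rfl
        exact hx0' (by rw [← hpy, map_zero])
      have h1 := hvmin y hy hy0
      have h2 := hpyth y
      rw [hpy] at h2
      have h3 : μ y ^ 2 ≤ 1 / 4 := by
        rw [← sq_abs]
        nlinarith [abs_nonneg (μ y)]
      show l / 2 ≤ ‖p x‖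
      by_contra! hlt
      have h4 : ‖p x‖ ^ 2 < ‖v‖ ^ 2 / 4 := by nlinarith [norm_nonneg (p x)]
      have h5 : (10 / 11 * ‖v‖) ^ 2 ≤ ‖y‖ ^ 2 := by gcongr
      nlinarith [sq_nonneg ‖v‖, mul_le_mul_of_nonneg_right h3 (sq_nonneg ‖v‖)]
    have hspan : Submodule.span ℝ ((L.map p.toAddMonoidHom : AddSubgroup E) : Set E)
        < Submodule.span ℝ (L : Set E) := by
      have hmap : ∀ x ∈ Submodule.span ℝ ((L.map p.toAddMonoidHom : AddSubgroup E) : Set E),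
          x ∈ Submodule.span ℝ (L : Set E) ∧ inner ℝ v x = 0 := by
        intro x hx
        induction hx using Submodule.span_induction with
        | mem x hx =>
          obtain ⟨x, hx, rfl⟩ := hx
          refine ⟨?_, horth x⟩
          show p x ∈ _
          rw [hpx]
          exact Submodule.sub_mem _ (Submodule.subset_span hx)
            (Submodule.smul_mem _ _ (Submodule.subset_span hvL))
        | zero => simp
        | add x y _ _ h1 h2 =>
          exact ⟨Submodule.add_mem _ h1.1 h2.1, by rw [inner_add_right, h1.2, h2.2, add_zero]⟩
        | smul a x _ h1 =>
          exact ⟨Submodule.smul_mem _ _ h1.1, by rw [inner_smul_right, h1.2, mul_zero]⟩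
      refine lt_of_le_of_ne (fun x hx => (hmap x hx).1) fun heq => ?_
      have := (hmap v (heq ▸ Submodule.subset_span hvL)).2
      exact hv0 (inner_self_eq_zero.1 this)
    have hfr := Submodule.finrank_lt_finrank_of_lt hspan
    obtain ⟨r, hr, b', hb'L, hb'g, hb'c⟩ := ih (L.map p.toAddMonoidHom) (l / 2) (by positivity)
      (by omega) hpmin
    have hlift : ∀ i, ∃ y ∈ L, p y = b' i ∧ |μ y| ≤ 1 / 2 := by
      intro i
      obtain ⟨x, hx, hxb⟩ := hb'L i
      obtain ⟨y, hy, n, -, hpy, hμy⟩ := hround x hx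
      exact ⟨y, hy, hpy.trans hxb, hμy⟩
    choose b hbL hbp hbμ using hlift
    refine ⟨r + 1, by omega, Fin.cons v b, ?_, ?_, ?_⟩
    · intro i
      refine Fin.cases hvL (fun j => ?_) i
      simpa using hbL j
    · intro x hx
      obtain ⟨z, hz⟩ := hb'g (p x) ⟨x, hx, rfl⟩
      -- What remains after subtracting the lifted generators is a multiple of `v`; rounded, it has
      -- length at most `‖v‖ / 2`, so it vanishes.
      obtain ⟨y, hy, n, hyx, hpy, hμy⟩ := hround (x - ∑ i, z i • b i)
        (L.sub_mem hx (L.sum_mem fun i _ => L.zsmul_mem (hbL i) _))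
      have hpy0 : p y = 0 := by
        rw [hpy, map_sub, map_sum, hz]
        simp [map_zsmul, hbp]
      have hy0 : y = 0 := by
        by_contra hy0
        have h1 := hvmin y hy hy0
        have h2 := hpyth y
        rw [hpy0, norm_zero] at h2
        have h3 : μ y ^ 2 ≤ 1 / 4 := by
          rw [← sq_abs]
          nlinarith [abs_nonneg (μ y)]
        have h5 : (10 / 11 * ‖v‖) ^ 2 ≤ ‖y‖ ^ 2 := by gcongr
        nlinarith [sq_pos_of_pos hvpos, mul_le_mul_of_nonneg_right h3 (sq_nonneg ‖v‖)]
      refine ⟨Fin.cons n z, ?_⟩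
      rw [Fin.sum_univ_succ]
      simp only [Fin.cons_zero, Fin.cons_succ]
      rw [hy0] at hyx
      rw [eq_comm, sub_sub, sub_eq_zero] at hyx
      rw [hyx, add_comm]
    · intro t
      rw [Fin.sum_univ_succ]
      simp only [Fin.cons_zero, Fin.cons_succ]
      set x := t 0 • v + ∑ i : Fin r, t i.succ • b i with hx
      have hpx' : p x = ∑ i : Fin r, t i.succ • b' i := by
        simp [hx, hpv, hbp]
      have hple : ‖p x‖ ≤ ‖x‖ := by
        refine abs_le_of_sq_le_sq' ?_ (norm_nonneg _) |>.2
        have := hpyth x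
        nlinarith [mul_nonneg (sq_nonneg (μ x)) (sq_nonneg ‖v‖)]
      have hsucc : ∀ i : Fin r, c * (l / 2) * |t i.succ| ≤ ‖x‖ := fun i =>
        (hb'c (fun i => t i.succ) i).trans (hpx' ▸ hple)
      have hμle : |μ x| * ‖v‖ ≤ ‖x‖ := by
        refine abs_le_of_sq_le_sq' ?_ (norm_nonneg _) |>.2
        have := hpyth x
        rw [mul_pow, sq_abs]
        nlinarith [sq_nonneg ‖p x‖]
      have hμx : μ x = t 0 + ∑ i : Fin r, t i.succ * μ (b i) := by
        simp [hx, hμv]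
      have h0 : |t 0| ≤ |μ x| + ∑ i : Fin r, |t i.succ| * (1 / 2) := by
        -- The lifts have `|μ| ≤ 1 / 2`, so the coordinates already controlled perturb `t 0` by a
        -- bounded multiple of `‖x‖ / l`.
        have e : t 0 = μ x - ∑ i : Fin r, t i.succ * μ (b i) := by rw [hμx]; ring
        rw [e]
        refine (abs_sub _ _).trans ?_
        gcongr
        refine (Finset.abs_sum_le_sum_abs _ _).trans (Finset.sum_le_sum fun i _ => ?_)
        rw [abs_mul]
        gcongr
        exact hbμ i
      intro i
      refine Fin.cases ?_ (fun j => ?_) i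
      · have h1 : l * |t 0| ≤ (1 + d / c) * ‖x‖ := by
          have hA : l * |μ x| ≤ ‖x‖ := by nlinarith [abs_nonneg (μ x)]
          have hB : ∀ i : Fin r, l * (|t i.succ| * (1 / 2)) ≤ ‖x‖ / c := by
            intro i
            rw [le_div_iff₀ hc]
            linarith [hsucc i]
          have hC : l * ∑ i : Fin r, |t i.succ| * (1 / 2) ≤ d * (‖x‖ / c) := by
            rw [Finset.mul_sum]
            refine (Finset.sum_le_card_nsmul _ _ _ fun i _ => hB i).trans ?_
            rw [nsmul_eq_mul, Finset.card_univ, Fintype.card_fin]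
            have : (r : ℝ) ≤ d := by exact_mod_cast hr
            gcongr
          calc l * |t 0| ≤ l * (|μ x| + ∑ i : Fin r, |t i.succ| * (1 / 2)) := by gcongr
            _ = l * |μ x| + l * ∑ i : Fin r, |t i.succ| * (1 / 2) := by ring
            _ ≤ ‖x‖ + d * (‖x‖ / c) := add_le_add hA hC
            _ = _ := by ring
        have hpos : (0 : ℝ) < 1 + d / c := by positivity
        calc _ ≤ (1 + d / c)⁻¹ * l * |t 0| := by
              gcongr
              exact min_le_right _ _
          _ = (1 + d / c)⁻¹ * (l * |t 0|) := by ring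
          _ ≤ (1 + d / c)⁻¹ * ((1 + d / c) * ‖x‖) := by gcongr
          _ = ‖x‖ := by field_simp
      · refine le_trans ?_ (hsucc j)
        have : min (c / 2) (1 + d / c)⁻¹ ≤ c / 2 := min_le_left _ _
        calc _ ≤ c / 2 * l * |t j.succ| := by gcongr
          _ = _ := by ring

end IncompleteNorm

/-! ### Integer points in cosets of sublattices of `ℤᵐ`. -/

namespace IncompleteNorm

open MeasureTheory

/-- A subgroup of finite index of `ℤᵐ` without nonzero vectors in a cube has a basis in which the
coordinates of a vector are controlled by its size. -/
theorem exists_reduced_basis (m : ℕ) : ∃ c : ℝ, 0 < c ∧ ∀ (Λ : AddSubgroup (Fin m → ℤ)) (l : ℝ),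
    Λ.index ≠ 0 → 0 < l → (∀ x ∈ Λ, x ≠ 0 → ∃ i, l ≤ |(x i : ℝ)|) →
    ∃ b : Fin m → Fin m → ℤ, (∀ i, b i ∈ Λ) ∧ (∀ x ∈ Λ, ∃ z : Fin m → ℤ, x = ∑ i, z i • b i) ∧
      (∀ (t : Fin m → ℝ) (M : ℝ), 0 ≤ M → (∀ j, |∑ k, t k * (b k j : ℝ)| ≤ M) →
        ∀ i, c * l * |t i| ≤ M) ∧ |((Matrix.of b).det : ℝ)| = Λ.index := by
  obtain ⟨c, hc, H⟩ := exists_reduced_generators (EuclideanSpace ℝ (Fin m)) m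
  -- The factor `m + 1` compares the Euclidean norm with the supremum norm; the `+ 1` keeps the
  -- constant meaningful for `m = 0`.
  refine ⟨c / (m + 1), by positivity, fun Λ l hΛ hl hmin => ?_⟩
  set ι : (Fin m → ℤ) →+ EuclideanSpace ℝ (Fin m) :=
    { toFun := fun x => WithLp.toLp 2 fun i => (x i : ℝ)
      map_zero' := by ext i; simp
      map_add' := fun x y => by ext i; simp } with hι
  have hιa : ∀ x i, ι x i = (x i : ℝ) := fun x i => rfl
  have hιinj : Function.Injective ι := by
    intro x y h
    ext i
    have := congrArg (fun v : EuclideanSpace ℝ (Fin m) => v i) h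
    simpa [hιa] using this
  obtain ⟨r, hr, b', hb'L, hb'g, hb'c⟩ := H (Λ.map ι) l hl
    ((Submodule.finrank_le _).trans (by simp)) (by
      rintro _ ⟨x, hx, rfl⟩ hx0
      obtain ⟨i, hi⟩ := hmin x hx (by rintro rfl; exact hx0 (map_zero _))
      refine hi.trans ?_
      rw [← hιa, ← Real.norm_eq_abs]
      exact PiLp.norm_apply_le (ι x) i)
  choose b hbΛ hbb using hb'L
  have hgen : ∀ x ∈ Λ, ∃ z : Fin r → ℤ, x = ∑ i, z i • b i := by
    intro x hx
    obtain ⟨z, hz⟩ := hb'g (ι x) ⟨x, hx, rfl⟩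
    refine ⟨z, hιinj ?_⟩
    rw [hz, map_sum]
    exact Finset.sum_congr rfl fun i _ => by rw [map_zsmul, hbb]
  have hrm : r = m := by
    refine le_antisymm hr ?_
    -- The index times each standard vector lies in `Λ`, so the generators span and their number is
    -- exactly `m`.
    have htop : Submodule.span ℝ (Set.range b') = ⊤ := by
      rw [eq_top_iff, ← (EuclideanSpace.basisFun (Fin m) ℝ).toBasis.span_eq, Submodule.span_le]
      rintro _ ⟨i, rfl⟩
      obtain ⟨z, hz⟩ := hgen (Λ.index • Pi.single i 1)
        (AddSubgroup.nsmul_index_mem Λ _)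
      have h1 : ι (Λ.index • Pi.single i 1) ∈ Submodule.span ℝ (Set.range b') := by
        rw [hz, map_sum]
        refine Submodule.sum_mem _ fun j _ => ?_
        rw [map_zsmul, hbb]
        exact zsmul_mem (Submodule.subset_span (Set.mem_range_self j)) _
      have h2 : (EuclideanSpace.basisFun (Fin m) ℝ).toBasis i
          = (Λ.index : ℝ)⁻¹ • ι (Λ.index • Pi.single i 1) := by
        have h0 : (Λ.index : ℝ) ≠ 0 := by exact_mod_cast hΛ
        ext j
        simp only [OrthonormalBasis.coe_toBasis, EuclideanSpace.basisFun_apply,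
          PiLp.smul_apply, hιa, smul_eq_mul, Pi.smul_apply]
        rw [nsmul_eq_mul, Int.cast_mul, Int.cast_natCast, inv_mul_cancel_left₀ h0]
        by_cases hij : j = i
        · subst hij; simp
        · simp [hij]
      rw [h2]
      exact Submodule.smul_mem _ _ h1
    have := finrank_range_le_card (R := ℝ) b'
    rw [Set.finrank, htop] at this
    simpa using this
  subst hrm
  have hbound : ∀ (t : Fin r → ℝ) (M : ℝ), 0 ≤ M → (∀ j, |∑ k, t k * (b k j : ℝ)| ≤ M) →
      ∀ i, c / (r + 1) * l * |t i| ≤ M := by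
    intro t M hM hj i
    have h1 := hb'c t i
    have h2 : ‖∑ j, t j • b' j‖ ≤ (r + 1) * M := by
      have h3 : ‖∑ j, t j • b' j‖ ≤ ∑ j : Fin r, |∑ k, t k * (b k j : ℝ)| := by
        have : ∑ j, t j • b' j = ∑ j, EuclideanSpace.single j (∑ k, t k * (b k j : ℝ)) := by
          ext j
          simp [← hbb, hιa, Finset.sum_apply]
        rw [this]
        refine (norm_sum_le _ _).trans (Finset.sum_le_sum fun j _ => ?_)
        simp
      refine h3.trans ((Finset.sum_le_card_nsmul _ _ M fun j _ => hj j).trans ?_)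
      rw [nsmul_eq_mul, Finset.card_univ, Fintype.card_fin]
      linarith
    have h4 : (0 : ℝ) < r + 1 := by positivity
    have : c / (r + 1) * l * |t i| = (c * l * |t i|) / (r + 1) := by ring
    rw [this, div_le_iff₀ h4]
    linarith
  refine ⟨b, hbΛ, hgen, hbound, ?_⟩
  -- A vanishing combination has size `M = 0`, and the coordinate bound then kills every
  -- coefficient.
  have hli : LinearIndependent ℤ fun i => (⟨b i, hbΛ i⟩ : Λ) := by
    rw [Fintype.linearIndependent_iff]
    intro z hz i
    have hz' : ∑ k, z k • b k = 0 := by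
      have := congrArg (fun y : Λ => (y : Fin r → ℤ)) hz
      simpa using this
    have := hbound (fun k => (z k : ℝ)) 0 le_rfl (fun j => by
      have h1 : ∑ k, z k * b k j = 0 := by
        have := congrFun hz' j
        simpa using this
      have h2 : ∑ k, (z k : ℝ) * (b k j : ℝ) = 0 := by exact_mod_cast h1
      simp [h2]) i
    have hpos : 0 < c / (r + 1) * l := by positivity
    have h3 : |(z i : ℝ)| ≤ 0 := by
      by_contra! h
      nlinarith
    simpa using h3
  have hsp : ⊤ ≤ Submodule.span ℤ (Set.range fun i => (⟨b i, hbΛ i⟩ : Λ)) := by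
    rintro ⟨x, hx⟩ -
    obtain ⟨z, hz⟩ := hgen x hx
    have : (⟨x, hx⟩ : Λ) = ∑ i, z i • (⟨b i, hbΛ i⟩ : Λ) := by
      ext1
      simp [hz]
    rw [this]
    exact Submodule.sum_mem _ fun i _ => Submodule.smul_mem _ _ (Submodule.subset_span ⟨i, rfl⟩)
  have hidx := AddSubgroup.index_eq_natAbs_det (Pi.basisFun ℤ (Fin r)) Λ (Module.Basis.mk hli hsp)
  rw [hidx, Pi.basisFun_det, Nat.cast_natAbs, ← Int.cast_abs]
  simp [Matrix.detRowAlternating, Matrix.of]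
  rfl

/-- Number of integer points of a region in a coset of `Q Λ`. -/
theorem exists_abs_ncard_coset_sub_le (m h : ℕ) : ∃ C : ℝ, 0 ≤ C ∧
    ∀ (Λ : AddSubgroup (Fin m → ℤ)) (l X : ℝ) (Q : ℕ) (x₁ : Fin m → ℤ) (R : Set (Fin m → ℝ)),
    Λ.index ≠ 0 → 0 < l → (∀ x ∈ Λ, x ≠ 0 → ∃ i, l ≤ |(x i : ℝ)|) → 1 ≤ Q → 0 ≤ X →
    MeasurableSet R → R ⊆ Set.Icc (fun _ => -X) (fun _ => X) → LinesMeetInIntervals h R →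
    |({x : Fin m → ℤ | (fun i => (x i : ℝ)) ∈ R ∧ ∃ y ∈ Λ, x = x₁ + Q • y}.ncard : ℝ)
      - volume.real R / ((Q : ℝ) ^ m * Λ.index)| ≤ C * (1 + X / (Q * l)) ^ (m - 1) := by
  obtain ⟨c, hc, H⟩ := exists_reduced_basis m
  refine ⟨2 ^ h * m * (1 + 4 / c) ^ (m - 1), by positivity, ?_⟩
  intro Λ l X Q x₁ R hΛ hl hmin hQ hX hRm hRX hRl
  obtain ⟨b, hbΛ, hbg, hbc, hbdet⟩ := H Λ l hΛ hl hmin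
  have hQ0 : (0 : ℝ) < Q := by exact_mod_cast hQ
  have hΛ0 : (0 : ℝ) < Λ.index := by exact_mod_cast Nat.pos_of_ne_zero hΛ
  set B : Matrix (Fin m) (Fin m) ℝ := (Q : ℝ) • ((Matrix.of b).map (Int.castRingHom ℝ)).transpose
    with hB
  set A : (Fin m → ℝ) →ₗ[ℝ] (Fin m → ℝ) := Matrix.toLin' B with hA
  have hAa : ∀ t j, A t j = Q * ∑ k, t k * (b k j : ℝ) := by
    intro t j
    simp only [hA, hB, Matrix.toLin'_apply, Matrix.mulVec, dotProduct, Matrix.smul_apply,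
      Matrix.transpose_apply, Matrix.map_apply, Matrix.of_apply, smul_eq_mul, Finset.mul_sum]
    exact Finset.sum_congr rfl fun k _ => by simp; ring
  have hAdet : |LinearMap.det A| = Q ^ m * Λ.index := by
    rw [hA, LinearMap.det_toLin', hB, Matrix.det_smul, Matrix.det_transpose, ← RingHom.mapMatrix_apply,
      ← RingHom.map_det, abs_mul, abs_pow, Nat.abs_cast, Fintype.card_fin]
    congr 1
  have hAdet0 : LinearMap.det A ≠ 0 := by
    rw [← abs_pos, hAdet]
    positivity
  set x₁' : Fin m → ℝ := fun i => (x₁ i : ℝ) with hx₁'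
  have hAb : ∀ (t : Fin m → ℝ) (M : ℝ), 0 ≤ M → (∀ j, |A t j| ≤ M) →
      ∀ i, |t i| ≤ M / (Q * (c * l)) := by
    intro t M hM hj i
    have := hbc t (M / Q) (by positivity) (fun j => by
      have := hj j
      rw [hAa, abs_mul, Nat.abs_cast] at this
      rw [le_div_iff₀ hQ0]
      linarith) i
    rw [le_div_iff₀ (by positivity)]
    rw [le_div_iff₀ hQ0] at this
    linarith
  set R' : Set (Fin m → ℝ) := {t | x₁' + A t ∈ R} with hR'
  have hAcont : Continuous A := A.continuous_of_finiteDimensional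
  have hR'm : MeasurableSet R' := (continuous_const.add hAcont).measurable hRm
  -- The injective affine map `t ↦ x₁' + A t` sends lines to lines of arbitrary direction, so `h`
  -- does not change.
  have hR'l : LinesMeetInIntervals h R' := by
    intro a v hv
    obtain ⟨I, hI, hU⟩ := hRl (x₁' + A a) (A v) (fun h0 => hv (by
      ext i
      have := hAb v 0 le_rfl (fun j => by simp [h0]) i
      simpa using this))
    refine ⟨I, hI, ?_⟩
    rw [← hU]
    ext s
    simp only [hR', Set.mem_ofPred_eq, map_add, map_smul, add_assoc]
  have hvol : volume.real R' = volume.real R / ((Q : ℝ) ^ m * Λ.index) := by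
    have h1 : R' = A ⁻¹' ((fun y => x₁' + y) ⁻¹' R) := rfl
    rw [h1, measureReal_def, Measure.addHaar_preimage_linearMap _ hAdet0, measure_preimage_add,
      ENNReal.toReal_mul, ENNReal.toReal_ofReal (abs_nonneg _), abs_inv, hAdet, ← measureReal_def]
    rw [div_eq_inv_mul]
  have hcount : {x : Fin m → ℤ | (fun i => (x i : ℝ)) ∈ R ∧ ∃ y ∈ Λ, x = x₁ + Q • y}.ncard
      = {z : Fin m → ℤ | (fun i => (z i : ℝ)) ∈ R'}.ncard := by
    have key : ∀ z : Fin m → ℤ, (fun i => ((x₁ + Q • ∑ k, z k • b k) i : ℝ))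
        = x₁' + A (fun i => (z i : ℝ)) := by
      intro z
      ext j
      simp [hAa, hx₁', Finset.sum_apply]
    symm
    refine Set.ncard_congr (fun z _ => x₁ + Q • ∑ k, z k • b k) ?_ ?_ ?_
    · intro z hz
      refine ⟨?_, _, Λ.sum_mem fun k _ => Λ.zsmul_mem (hbΛ k) _, rfl⟩
      rw [key]
      exact hz
    · intro z z' _ _ hzz
      have h1 : A (fun i => (z i : ℝ)) = A (fun i => (z' i : ℝ)) := by
        have := key z
        rw [hzz, key z'] at this
        exact (add_left_cancel this).symm
      ext i
      have := hAb (fun i => (z i : ℝ) - (z' i : ℝ)) 0 le_rfl (fun j => by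
        have : A (fun i => (z i : ℝ) - (z' i : ℝ)) = 0 := by
          rw [show (fun i => (z i : ℝ) - (z' i : ℝ)) = (fun i => (z i : ℝ)) - fun i => (z' i : ℝ)
            from rfl, map_sub, h1, sub_self]
        simp [this]) i
      have h2 : (z i : ℝ) - z' i = 0 := by simpa using this
      exact_mod_cast sub_eq_zero.1 h2
    · rintro x ⟨hxR, y, hy, rfl⟩
      obtain ⟨z, rfl⟩ := hbg y hy
      refine ⟨z, ?_, rfl⟩
      rw [key] at hxR
      exact hxR
  rw [hcount, ← hvol]
  rcases R'.eq_empty_or_nonempty with hemp | ⟨t₀, ht₀⟩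
  · rw [hemp]
    simp only [Set.mem_empty_iff_false, Set.ofPred_false, Set.ncard_empty, measureReal_empty]
    simp only [Nat.cast_zero, sub_zero, abs_zero]
    positivity
  -- Two points of `R` differ by at most `2 * X` in each coordinate, so coordinate control puts `R'`
  -- in a cube of side `2 * M` centred at any of its points.
  · set M := 2 * X / (Q * (c * l)) with hM
    have hM0 : 0 ≤ M := by positivity
    have hbox : R' ⊆ Set.Icc (fun i => t₀ i - M) (fun i => (t₀ i - M) + 2 * M) := by
      intro t ht
      have h1 : ∀ i, |(t - t₀) i| ≤ M := hAb (t - t₀) (2 * X) (by positivity) (fun j => by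
        have e1 := hRX ht
        have e2 := hRX ht₀
        have a1 := e1.1 j
        have a2 := e1.2 j
        have a3 := e2.1 j
        have a4 := e2.2 j
        simp only [Pi.add_apply] at a1 a2 a3 a4
        rw [map_sub, Pi.sub_apply, abs_le]
        constructor <;> linarith)
      refine ⟨fun i => ?_, fun i => ?_⟩ <;>
      · have := abs_le.1 (h1 i)
        simp only [Pi.sub_apply] at this ⊢
        linarith [this.1, this.2]
    refine (hR'l.abs_ncard_sub_volume_le hR'm (by positivity) hbox).trans ?_
    rw [mul_assoc _ ((1 + 4 / c) ^ (m - 1)), ← mul_pow]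
    gcongr
    have : 2 * M = 4 / c * (X / (Q * l)) := by
      rw [hM]
      field_simp
      ring
    rw [this]
    have h5 : 0 ≤ 4 / c := by positivity
    have h6 : 0 ≤ X / (Q * l) := by positivity
    nlinarith

end IncompleteNorm

/-! ### Shortest vectors, indices and congruences. -/

namespace IncompleteNorm

open MeasureTheory

/-- The largest absolute value of a coordinate of an integer vector. -/
def supAbs {m : ℕ} (x : Fin m → ℤ) : ℕ := Finset.univ.sup fun i => (x i).natAbs

theorem natAbs_le_supAbs {m : ℕ} (x : Fin m → ℤ) (i : Fin m) : (x i).natAbs ≤ supAbs x :=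
  Finset.le_sup (f := fun i => (x i).natAbs) (Finset.mem_univ i)

theorem supAbs_eq_zero {m : ℕ} {x : Fin m → ℤ} : supAbs x = 0 ↔ x = 0 := by
  simp [supAbs, funext_iff]

theorem exists_natAbs_eq_supAbs {m : ℕ} {x : Fin m → ℤ} (hx : x ≠ 0) :
    ∃ i, (x i).natAbs = supAbs x := by
  have hne : (Finset.univ : Finset (Fin m)).Nonempty := by
    by_contra h
    rw [Finset.not_nonempty_iff_eq_empty, Finset.univ_eq_empty_iff] at h
    exact hx (Subsingleton.elim _ _)
  obtain ⟨i, -, hi⟩ := Finset.exists_mem_eq_sup Finset.univ hne fun i => (x i).natAbs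
  exact ⟨i, hi.symm⟩

/-- The length, in the supremum norm, of a shortest nonzero vector. -/
noncomputable def minAbs {m : ℕ} (Λ : AddSubgroup (Fin m → ℤ)) : ℕ :=
  sInf {s | ∃ x ∈ Λ, x ≠ 0 ∧ supAbs x = s}

theorem exists_supAbs_eq_minAbs {m : ℕ} (hm : 0 < m) {Λ : AddSubgroup (Fin m → ℤ)}
    (hΛ : Λ.index ≠ 0) : ∃ x ∈ Λ, x ≠ 0 ∧ supAbs x = minAbs Λ := by
  refine Nat.sInf_mem (s := {s | ∃ x ∈ Λ, x ≠ 0 ∧ supAbs x = s}) ?_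
  refine ⟨_, Λ.index • (fun _ => 1), AddSubgroup.nsmul_index_mem Λ _, fun h => ?_, rfl⟩
  have := congrFun h ⟨0, hm⟩
  simp at this
  exact hΛ (by simpa using this)

theorem minAbs_pos {m : ℕ} (hm : 0 < m) {Λ : AddSubgroup (Fin m → ℤ)} (hΛ : Λ.index ≠ 0) :
    0 < minAbs Λ := by
  obtain ⟨x, -, hx0, hx⟩ := exists_supAbs_eq_minAbs hm hΛ
  rw [← hx, Nat.pos_iff_ne_zero, Ne, supAbs_eq_zero]
  exact hx0

theorem minAbs_le_supAbs {m : ℕ} {Λ : AddSubgroup (Fin m → ℤ)} {x : Fin m → ℤ} (hx : x ∈ Λ)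
    (hx0 : x ≠ 0) : minAbs Λ ≤ supAbs x :=
  Nat.sInf_le ⟨x, hx, hx0, rfl⟩

theorem minAbs_le_abs {m : ℕ} {Λ : AddSubgroup (Fin m → ℤ)} {x : Fin m → ℤ} (hx : x ∈ Λ)
    (hx0 : x ≠ 0) : ∃ i, (minAbs Λ : ℝ) ≤ |(x i : ℝ)| := by
  obtain ⟨i, hi⟩ := exists_natAbs_eq_supAbs hx0
  refine ⟨i, ?_⟩
  rw [← Int.cast_abs, ← Nat.cast_natAbs, hi]
  exact_mod_cast minAbs_le_supAbs hx hx0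

/-- Pigeonhole form of Minkowski's bound: two distinct points of `[0, minAbs Λ)ᵐ` differ by a
nonzero vector shorter than `minAbs Λ`, so they lie in different cosets of `Λ`. -/
theorem minAbs_pow_le_index {m : ℕ} {Λ : AddSubgroup (Fin m → ℤ)} (hΛ : Λ.index ≠ 0) :
    minAbs Λ ^ m ≤ Λ.index := by
  have : Finite ((Fin m → ℤ) ⧸ Λ) := Nat.finite_of_card_ne_zero hΛ
  have hinj : Function.Injective fun u : Fin m → Fin (minAbs Λ) =>
      (QuotientAddGroup.mk (fun i => ((u i : ℕ) : ℤ)) : (Fin m → ℤ) ⧸ Λ) := by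
    intro u v huv
    rw [QuotientAddGroup.eq] at huv
    by_contra hne
    have h0 : (-(fun i => ((u i : ℕ) : ℤ)) + fun i => ((v i : ℕ) : ℤ)) ≠ 0 := by
      intro h0
      refine hne (funext fun i => Fin.ext ?_)
      have := congrFun h0 i
      simp only [Pi.add_apply, Pi.neg_apply, Pi.zero_apply] at this
      omega
    obtain ⟨i, hi⟩ := exists_natAbs_eq_supAbs h0
    have h1 := minAbs_le_supAbs huv h0
    rw [← hi] at h1
    have h2 := (u i).2
    have h3 := (v i).2
    simp only [Pi.add_apply, Pi.neg_apply] at h1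
    omega
  have := Nat.card_le_card_of_injective _ hinj
  simpa [AddSubgroup.index] using this

/-- A subgroup of `ℤᵐ` containing `N ℤᵐ` has `Nᵐ / index` elements in `[1, N]ᵐ`. -/
theorem ncard_box_mul_index {m : ℕ} {Λ : AddSubgroup (Fin m → ℤ)} {N : ℕ} (hN : N ≠ 0)
    (hΛ : ∀ x : Fin m → ℤ, N • x ∈ Λ) :
    {x : Fin m → ℤ | (∀ i, 1 ≤ x i ∧ x i ≤ (N : ℤ)) ∧ x ∈ Λ}.ncard * Λ.index = N ^ m := by
  have : NeZero N := ⟨hN⟩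
  -- The box is a full set of representatives mod `N`, and `Λ` contains the kernel of reduction, so
  -- the count is the order of the image of `Λ`.
  set f : (Fin m → ℤ) →+ (Fin m → ZMod N) :=
    { toFun := fun x i => (x i : ZMod N)
      map_zero' := by ext; simp
      map_add' := fun x y => by ext; simp } with hf
  have hfa : ∀ x i, f x i = (x i : ZMod N) := fun _ _ => rfl
  have hsurj : Function.Surjective f := fun y => by
    refine ⟨fun i => ((y i).val : ℤ), ?_⟩
    ext i
    simp [hfa]
  have hdvd : ∀ x y, f x = f y → ∀ i, (N : ℤ) ∣ y i - x i := fun x y h i => by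
    have := congrFun h i
    rw [hfa, hfa, ZMod.intCast_eq_intCast_iff_dvd_sub] at this
    exact this
  have hmem : ∀ x y, f x = f y → x ∈ Λ → y ∈ Λ := fun x y h hx => by
    choose w hw using hdvd x y h
    have : y = x + N • w := by
      ext i
      have := hw i
      simp only [Pi.add_apply, Pi.smul_apply]
      rw [nsmul_eq_mul]
      linarith
    rw [this]
    exact Λ.add_mem hx (hΛ w)
  have hker : f.ker ≤ Λ := fun x hx =>
    hmem 0 x (by rw [map_zero]; exact (AddMonoidHom.mem_ker.1 hx).symm) Λ.zero_mem
  have hidx : (Λ.map f).index = Λ.index := by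
    rw [AddSubgroup.index_map, sup_eq_left.2 hker, AddMonoidHom.range_eq_top.2 hsurj]
    simp
  have hcard : {x : Fin m → ℤ | (∀ i, 1 ≤ x i ∧ x i ≤ (N : ℤ)) ∧ x ∈ Λ}.ncard
      = Nat.card (Λ.map f) := by
    rw [← SetLike.coe_sort_coe, Nat.card_coe_set_eq]
    refine Set.ncard_congr (fun x _ => f x) (fun x hx => ⟨x, hx.2, rfl⟩) ?_ ?_
    · intro x y hx hy hxy
      ext i
      obtain ⟨w, hw⟩ := hdvd x y hxy i
      have h1 := hx.1 i
      have h2 := hy.1 i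
      have : w = 0 := by
        have hN' : (0 : ℤ) < N := by exact_mod_cast Nat.pos_of_ne_zero hN
        have u1 : N * w < N * 1 := by linarith
        have u2 : (N : ℤ) * (-1) < N * w := by linarith
        have := lt_of_mul_lt_mul_left u1 hN'.le
        have := lt_of_mul_lt_mul_left u2 hN'.le
        omega
      rw [this] at hw
      linarith
    · rintro _ ⟨x, hx, rfl⟩
      have hN' : (0 : ℤ) < N := by exact_mod_cast Nat.pos_of_ne_zero hN
      -- The shift by one places residues in `[1, N]` instead of `[0, N - 1]`.
      have hfx : f (fun i => (x i - 1) % N + 1) = f x := by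
        ext i
        rw [hfa, hfa, ZMod.intCast_eq_intCast_iff_dvd_sub]
        refine ⟨(x i - 1) / N, ?_⟩
        have := Int.emod_add_mul_ediv (x i - 1) N
        linarith
      refine ⟨fun i => (x i - 1) % N + 1, ⟨fun i => ?_, hmem x _ hfx.symm hx⟩, hfx⟩
      have := Int.emod_nonneg (x i - 1) hN'.ne'
      have := Int.emod_lt_of_pos (x i - 1) hN'
      constructor <;> linarith
  rw [hcard, ← hidx, AddSubgroup.card_mul_index]
  simp

/-- The simultaneous conditions `x ∈ Λ` and `x ≡ x₀ (mod Q)` define a coset of `Q Λ`. -/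
theorem exists_coset_rep {m : ℕ} {Λ : AddSubgroup (Fin m → ℤ)} {N Q : ℕ} (hNQ : N.Coprime Q)
    (hΛ : ∀ x : Fin m → ℤ, N • x ∈ Λ) (x₀ : Fin m → ℤ) :
    ∃ x₁ : Fin m → ℤ, ∀ x : Fin m → ℤ,
      ((∀ i, x i ≡ x₀ i [ZMOD (Q : ℤ)]) ∧ x ∈ Λ) ↔ ∃ y ∈ Λ, x = x₁ + Q • y := by
  obtain ⟨u, v, huv⟩ := Nat.isCoprime_iff_coprime.2 hNQ
  have hu : ∀ x, u * N * x + v * Q * x = x := fun x => by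
    rw [← add_mul, huv, one_mul]
  -- Chinese remainder theorem: with `u N + v Q = 1`, this vector is `≡ x₀` mod `Q` and lies in `N
  -- ℤᵐ ⊆ Λ`.
  refine ⟨N • u • x₀, fun x => ⟨fun ⟨hx, hxΛ⟩ => ?_, ?_⟩⟩
  · choose w hw using fun i => (hx i).symm.dvd
    have hxw : x = N • u • x₀ + Q • (w + v • x₀) := by
      ext i
      have := hw i
      have h2 := hu (x₀ i)
      simp only [Pi.add_apply, Pi.smul_apply]
      simp only [nsmul_eq_mul, smul_eq_mul]
      linear_combination this - h2
    refine ⟨w + v • x₀, ?_, hxw⟩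
    have h1 : (Q : ℤ) • (w + v • x₀) ∈ Λ := by
      have : (Q : ℤ) • (w + v • x₀) = x - N • u • x₀ := by
        conv_rhs => rw [hxw]
        rw [add_sub_cancel_left, natCast_zsmul]
      rw [this]
      exact Λ.sub_mem hxΛ (hΛ _)
    -- Both the `N`-fold and the `Q`-fold of this vector lie in `Λ`, hence so does the vector.
    have h2 : w + v • x₀ = u • N • (w + v • x₀) + v • (Q : ℤ) • (w + v • x₀) := by
      ext i
      have := hu ((w + v • x₀) i)
      simp only [Pi.add_apply, Pi.smul_apply] at this ⊢
      simp only [nsmul_eq_mul, smul_eq_mul] at this ⊢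
      linear_combination -this
    rw [h2]
    exact Λ.add_mem (Λ.zsmul_mem (hΛ _) _) (Λ.zsmul_mem h1 _)
  · rintro ⟨y, hy, rfl⟩
    refine ⟨fun i => ?_, Λ.add_mem (hΛ _) (Λ.nsmul_mem hy _)⟩
    refine (Int.modEq_iff_dvd.2 ⟨v * x₀ i - y i, ?_⟩)
    have h2 := hu (x₀ i)
    simp only [Pi.add_apply, Pi.smul_apply]
    simp only [nsmul_eq_mul, smul_eq_mul]
    linear_combination -h2

/-! ### The lattice attached to an ideal. -/

variable {K : Type*} [Field K] [NumberField K]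

/-- The map `x ↦ ∑ x_i α^{i-1}` as a homomorphism. -/
def eltHom (m : ℕ) (α : 𝓞 K) : (Fin m → ℤ) →+ 𝓞 K where
  toFun := elt α
  map_zero' := by simp [elt]
  map_add' x y := by simp [elt, add_mul, Finset.sum_add_distrib]

/-- The group of integer vectors `x` with `𝔡 ∣ (∑ x_i α^{i-1})`. -/
def coeffLattice (m : ℕ) (α : 𝓞 K) (𝔡 : Ideal (𝓞 K)) : AddSubgroup (Fin m → ℤ) :=
  (Submodule.toAddSubgroup 𝔡).comap (eltHom m α)

theorem mem_coeffLattice {K : Type*} [Field K] {m : ℕ} {α : 𝓞 K} {𝔡 : Ideal (𝓞 K)} {x : Fin m → ℤ} :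
    x ∈ coeffLattice m α 𝔡 ↔ elt α x ∈ 𝔡 := Iff.rfl

theorem nsmul_absNorm_mem_coeffLattice {m : ℕ} (α : 𝓞 K) (𝔡 : Ideal (𝓞 K)) (x : Fin m → ℤ) :
    Ideal.absNorm 𝔡 • x ∈ coeffLattice m α 𝔡 := by
  rw [mem_coeffLattice]
  have : elt α (Ideal.absNorm 𝔡 • x) = (Ideal.absNorm 𝔡 : 𝓞 K) * elt α x := by
    rw [← nsmul_eq_mul]
    exact map_nsmul (eltHom m α) (Ideal.absNorm 𝔡) x
  rw [this]
  exact Ideal.mul_mem_right _ _ (Ideal.absNorm_mem 𝔡)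

/-- The quotient of `ℤᵐ` by the lattice embeds in `𝓞 K / 𝔡`, a group of order `N(𝔡)`. -/
theorem index_coeffLattice_dvd {m : ℕ} (α : 𝓞 K) (𝔡 : Ideal (𝓞 K)) :
    (coeffLattice m α 𝔡).index ∣ Ideal.absNorm 𝔡 := by
  rw [coeffLattice, AddSubgroup.index_comap]
  exact AddSubgroup.relIndex_dvd_index_of_normal _ _

theorem index_coeffLattice_ne_zero {m : ℕ} {α : 𝓞 K} {𝔡 : Ideal (𝓞 K)}
    (h : Ideal.absNorm 𝔡 ≠ 0) : (coeffLattice m α 𝔡).index ≠ 0 :=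
  fun h0 => h (zero_dvd_iff.1 (h0 ▸ index_coeffLattice_dvd α 𝔡))

theorem minAbs_coeffLattice_pow_le {m : ℕ} {α : 𝓞 K} {𝔡 : Ideal (𝓞 K)}
    (h : Ideal.absNorm 𝔡 ≠ 0) : minAbs (coeffLattice m α 𝔡) ^ m ≤ Ideal.absNorm 𝔡 :=
  (minAbs_pow_le_index (index_coeffLattice_ne_zero h)).trans
    (Nat.le_of_dvd (Nat.pos_of_ne_zero h) (index_coeffLattice_dvd α 𝔡))

/-- This identifies the arithmetic density in the main term with the lattice density. The lattice
contains `N(𝔡) ℤᵐ`, so `[1, N(𝔡)]ᵐ` holds `N(𝔡)ᵐ / index` of its points. -/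
theorem rho_div_absNorm {m : ℕ} (hm : 0 < m) (α : 𝓞 K) {𝔡 : Ideal (𝓞 K)}
    (h : Ideal.absNorm 𝔡 ≠ 0) :
    rho m α 𝔡 / Ideal.absNorm 𝔡 = ((coeffLattice m α 𝔡).index : ℝ)⁻¹ := by
  have h1 := ncard_box_mul_index h (nsmul_absNorm_mem_coeffLattice (m := m) α 𝔡)
  have h2 : ((coeffLattice m α 𝔡).index : ℝ) ≠ 0 := by
    exact_mod_cast index_coeffLattice_ne_zero h
  have h3 : (Ideal.absNorm 𝔡 : ℝ) ≠ 0 := by exact_mod_cast h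
  have h4 : {x : Fin m → ℤ | (∀ i, 1 ≤ x i ∧ x i ≤ (Ideal.absNorm 𝔡 : ℤ)) ∧
      𝔡 ∣ Ideal.span {elt α x}} = {x : Fin m → ℤ | (∀ i, 1 ≤ x i ∧ x i ≤ (Ideal.absNorm 𝔡 : ℤ)) ∧
      x ∈ coeffLattice m α 𝔡} := by
    simp only [Ideal.dvd_span_singleton, mem_coeffLattice]
  have h5 : ({x : Fin m → ℤ | (∀ i, 1 ≤ x i ∧ x i ≤ (Ideal.absNorm 𝔡 : ℤ)) ∧
      x ∈ coeffLattice m α 𝔡}.ncard : ℝ) * (coeffLattice m α 𝔡).index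
      = (Ideal.absNorm 𝔡 : ℝ) ^ (m - 1) * Ideal.absNorm 𝔡 := by
    rw [← pow_succ, Nat.sub_add_cancel hm]
    exact_mod_cast h1
  rw [rho, h4, div_div, ← h5]
  field_simp
  have h6 : ({x : Fin m → ℤ | (∀ i, 1 ≤ x i ∧ x i ≤ (Ideal.absNorm 𝔡 : ℤ)) ∧
      x ∈ coeffLattice m α 𝔡}.ncard : ℝ) ≠ 0 := by
    intro h0
    rw [h0, zero_mul] at h5
    exact (mul_ne_zero (pow_ne_zero _ h3) h3) h5.symm
  field_simp

theorem rho_div_absNorm_nonneg {m : ℕ} (α : 𝓞 K) (𝔡 : Ideal (𝓞 K)) :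
    0 ≤ rho m α 𝔡 / Ideal.absNorm 𝔡 := by
  unfold rho
  positivity

/-- Exponent `m` would also hold; `m - 1` matches the average bounded in `exists_sum_minAbs_le`. -/
theorem rho_div_absNorm_le {m : ℕ} (hm : 0 < m) (α : 𝓞 K) {𝔡 : Ideal (𝓞 K)}
    (h : Ideal.absNorm 𝔡 ≠ 0) :
    rho m α 𝔡 / Ideal.absNorm 𝔡 ≤ ((minAbs (coeffLattice m α 𝔡) : ℝ) ^ (m - 1))⁻¹ := by
  rw [rho_div_absNorm hm α h]
  have hpos : 0 < minAbs (coeffLattice m α 𝔡) := minAbs_pos hm (index_coeffLattice_ne_zero h)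
  have h1 : minAbs (coeffLattice m α 𝔡) ^ (m - 1) ≤ (coeffLattice m α 𝔡).index :=
    (Nat.pow_le_pow_right hpos (Nat.sub_le _ _)).trans
      (minAbs_pow_le_index (index_coeffLattice_ne_zero h))
  have hpos' : (0 : ℝ) < minAbs (coeffLattice m α 𝔡) := by exact_mod_cast hpos
  gcongr
  exact_mod_cast h1

theorem ncard_multiplesIn {m : ℕ} {α : 𝓞 K}
    (hinj : Function.Injective (elt α : (Fin m → ℤ) → 𝓞 K)) (R : Set (Fin m → ℝ)) (Q : ℕ)
    (x₀ : Fin m → ℤ) (𝔡 : Ideal (𝓞 K)) :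
    (multiplesIn (eltSet α R Q x₀) 𝔡).ncard = {x : Fin m → ℤ | (fun i => (x i : ℝ)) ∈ R ∧
      ((∀ i, x i ≡ x₀ i [ZMOD (Q : ℤ)]) ∧ x ∈ coeffLattice m α 𝔡)}.ncard := by
  rw [← Set.ncard_image_of_injective _ hinj]
  congr 1
  ext c
  simp only [multiplesIn, eltSet, Ideal.dvd_span_singleton, Set.mem_image, Set.mem_ofPred_eq,
    mem_coeffLattice]
  constructor
  · rintro ⟨⟨x, h1, h2, rfl⟩, h3⟩
    exact ⟨x, ⟨h1, h2, h3⟩, rfl⟩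
  · rintro ⟨x, ⟨h1, h2, h3⟩, rfl⟩
    exact ⟨⟨x, h1, h2, rfl⟩, h3⟩

/-- The count of multiples of a fixed ideal `𝔡`. -/
theorem exists_abs_ncard_multiplesIn_sub_le {m : ℕ} (hm : 0 < m) (h : ℕ) : ∃ C : ℝ, 0 ≤ C ∧
    ∀ (α : 𝓞 K) (𝔡 : Ideal (𝓞 K)) (X : ℝ) (Q : ℕ) (x₀ : Fin m → ℤ) (R : Set (Fin m → ℝ)),
    Function.Injective (elt α : (Fin m → ℤ) → 𝓞 K) → Ideal.absNorm 𝔡 ≠ 0 →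
    (Ideal.absNorm 𝔡).Coprime Q → 1 ≤ Q → 0 ≤ X →
    MeasurableSet R → R ⊆ Set.Icc (fun _ => -X) (fun _ => X) → LinesMeetInIntervals h R →
    |((multiplesIn (eltSet α R Q x₀) 𝔡).ncard : ℝ)
      - rho m α 𝔡 / Ideal.absNorm 𝔡 * (volume.real R / (Q : ℝ) ^ m)|
      ≤ C * (1 + X ^ (m - 1) * ((minAbs (coeffLattice m α 𝔡) : ℝ) ^ (m - 1))⁻¹) := by
  obtain ⟨C, hC, H⟩ := exists_abs_ncard_coset_sub_le m h
  refine ⟨C * 2 ^ (m - 1), by positivity, ?_⟩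
  intro α 𝔡 X Q x₀ R hinj hd hcop hQ hX hRm hRX hRl
  have hidx : (coeffLattice m α 𝔡).index ≠ 0 := index_coeffLattice_ne_zero hd
  have hpos : (0 : ℝ) < minAbs (coeffLattice m α 𝔡) := by exact_mod_cast minAbs_pos hm hidx
  obtain ⟨x₁, hx₁⟩ := exists_coset_rep hcop (nsmul_absNorm_mem_coeffLattice (m := m) α 𝔡) x₀
  have hmain := H (coeffLattice m α 𝔡) (minAbs (coeffLattice m α 𝔡)) X Q x₁ R hidx hpos
    (fun x hx hx0 => minAbs_le_abs hx hx0) hQ hX hRm hRX hRl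
  rw [ncard_multiplesIn hinj, rho_div_absNorm hm α hd]
  simp only [hx₁]
  have e : ((coeffLattice m α 𝔡).index : ℝ)⁻¹ * (volume.real R / (Q : ℝ) ^ m)
      = volume.real R / ((Q : ℝ) ^ m * (coeffLattice m α 𝔡).index) := by
    rw [inv_mul_eq_div, div_div]
  rw [e]
  refine hmain.trans ?_
  rw [mul_assoc]
  refine mul_le_mul_of_nonneg_left ?_ hC
  set l : ℝ := (minAbs (coeffLattice m α 𝔡) : ℝ)
  have hQ1 : (1 : ℝ) ≤ Q := by exact_mod_cast hQ
  have h1 : X / (Q * l) ≤ X / l := by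
    gcongr
    nlinarith
  have h2 : 0 ≤ X / l := by positivity
  have h3 : 1 + X / (Q * l) ≤ 2 * max 1 (X / l) := by
    have := le_max_left 1 (X / l)
    have := le_max_right 1 (X / l)
    linarith
  calc (1 + X / (Q * l)) ^ (m - 1) ≤ (2 * max 1 (X / l)) ^ (m - 1) := by gcongr
    _ = 2 ^ (m - 1) * (max 1 (X / l)) ^ (m - 1) := mul_pow _ _ _
    _ ≤ 2 ^ (m - 1) * (1 + X ^ (m - 1) * (l ^ (m - 1))⁻¹) := by
      gcongr
      rw [← div_eq_mul_inv, ← div_pow]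
      rcases max_cases 1 (X / l) with ⟨h, -⟩ | ⟨h, -⟩ <;> rw [h]
      · rw [one_pow]
        have := pow_nonneg h2 (m - 1)
        linarith
      · linarith

end IncompleteNorm

/-! ### Counting ideals and divisors of ideals. -/

namespace IncompleteNorm

open MeasureTheory

variable (K : Type*) [Field K] [NumberField K]

/-- The number of ideals with norm in `[D, 2D]` is `O(D)`. -/
theorem exists_card_idealsBetween_le : ∃ C : ℝ, 0 ≤ C ∧ ∀ (D : ℝ) (Q : ℕ), 0 < D →
    ((idealsBetween K D Q).card : ℝ) ≤ C * D := by
  have hlim := NumberField.Ideal.tendsto_norm_le_div_atTop K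
  set c := (2 ^ NumberField.InfinitePlace.nrRealPlaces K * (2 * Real.pi) ^
    NumberField.InfinitePlace.nrComplexPlaces K * NumberField.Units.regulator K *
    NumberField.classNumber K) / (NumberField.Units.torsionOrder K *
    Real.sqrt |NumberField.discr K|)
  obtain ⟨s₀, hs₀⟩ := Filter.eventually_atTop.1 (hlim.eventually_le_const (lt_add_one c))
  have hfin : ∀ s : ℝ, {I : Ideal (𝓞 K) | (Ideal.absNorm I : ℝ) ≤ s}.Finite := fun s =>
    (Ideal.finite_setOfPred_absNorm_le (S := 𝓞 K) ⌊s⌋₊).subset fun _ h => Nat.le_floor h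
  have hle : ∀ (D s : ℝ) (Q : ℕ), 2 * D ≤ s → ((idealsBetween K D Q).card : ℝ)
      ≤ (Nat.card {I : Ideal (𝓞 K) // (Ideal.absNorm I : ℝ) ≤ s} : ℝ) := by
    intro D s Q hD
    have h1 : Nat.card {I : Ideal (𝓞 K) // (Ideal.absNorm I : ℝ) ≤ s}
        = {I : Ideal (𝓞 K) | (Ideal.absNorm I : ℝ) ≤ s}.ncard := Nat.card_coe_set_eq _
    rw [h1, ← Set.ncard_coe_finset, Nat.cast_le]
    refine Set.ncard_le_ncard (fun I hI => ?_) (hfin s)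
    have := (Set.Finite.mem_toFinset _).1 hI
    exact this.2.1.trans hD
  set M := max s₀ 1
  set N := (Nat.card {I : Ideal (𝓞 K) // (Ideal.absNorm I : ℝ) ≤ M} : ℝ)
  refine ⟨2 * |c + 1| + 2 * N, by positivity, fun D Q hD => ?_⟩
  by_cases hDM : M ≤ 2 * D
  · have h1 := hs₀ (2 * D) ((le_max_left _ _).trans hDM)
    rw [div_le_iff₀ (by positivity)] at h1
    have h2 := hle D (2 * D) Q le_rfl
    have h3 : 0 ≤ N * D := by positivity
    have h4 := mul_le_mul_of_nonneg_right (le_abs_self (c + 1)) hD.le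
    linarith
  -- For small `D` the asymptotic says nothing, but a nonempty range forces `2 * D ≥ 1`, so a
  -- constant bound is `O(D)`.
  · rcases (idealsBetween K D Q).eq_empty_or_nonempty with h0 | ⟨I, hI⟩
    · rw [h0]
      simp only [Finset.card_empty, Nat.cast_zero]
      positivity
    · have hI' := (Set.Finite.mem_toFinset _).1 hI
      have h1 : (1 : ℝ) ≤ 2 * D := by
        have h2 : (0 : ℝ) < Ideal.absNorm I := hD.trans_le hI'.1
        have h3 : 1 ≤ Ideal.absNorm I := by exact_mod_cast h2
        have h4 : (1 : ℝ) ≤ Ideal.absNorm I := by exact_mod_cast h3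
        exact h4.trans hI'.2.1
      have h2 := hle D M Q (not_le.1 hDM).le
      have h3 : 0 ≤ N := by positivity
      have h4 : 0 ≤ |c + 1| * D := by positivity
      nlinarith

/-- The divisor bound for integral ideals. -/
theorem exists_ncard_divisors_le (δ : ℝ) (hδ : 0 < δ) : ∃ C : ℝ, 0 ≤ C ∧
    ∀ 𝔞 : Ideal (𝓞 K), 𝔞 ≠ ⊥ → {𝔡 : Ideal (𝓞 K) | 𝔡 ∣ 𝔞}.Finite ∧
      ({𝔡 : Ideal (𝓞 K) | 𝔡 ∣ 𝔞}.ncard : ℝ) ≤ C * (Ideal.absNorm 𝔞 : ℝ) ^ δ := by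
  classical
  have hlog : 0 < Real.log 2 := Real.log_pos one_lt_two
  -- The divisor count is at most the product of `e + 1` over the prime powers exactly dividing `𝔞`.
  -- If `N(p) ^ δ ≥ 2`, then `e + 1 ≤ 2 ^ e ≤ N(p) ^ (e δ)` costs nothing. Each of the finitely many
  -- other primes costs a factor `c`, by Bernoulli's inequality `N(p) ^ (e δ) ≥ 1 + e δ log 2`.
  set c : ℝ := 1 + 1 / (δ * Real.log 2) with hc
  have hc1 : 1 ≤ c := by
    have : 0 ≤ 1 / (δ * Real.log 2) := by positivity
    linarith
  have hSfin := Ideal.finite_setOfPred_absNorm_le (S := 𝓞 K) ⌈(2 : ℝ) ^ (1 / δ)⌉₊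
  set S := hSfin.toFinset with hS
  refine ⟨c ^ S.card, by positivity, fun 𝔞 ha => ?_⟩
  set F := UniqueFactorizationMonoid.normalizedFactors 𝔞 with hF
  have hmaps : ∀ 𝔡 ∈ {𝔡 : Ideal (𝓞 K) | 𝔡 ∣ 𝔞},
      UniqueFactorizationMonoid.normalizedFactors 𝔡 ∈ (Finset.Iic F : Set (Multiset (Ideal (𝓞 K)))) := by
    intro 𝔡 hd
    have hd0 : 𝔡 ≠ 0 := fun h0 => ha (zero_dvd_iff.1 (h0 ▸ hd))
    rw [Finset.mem_coe, Finset.mem_Iic]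
    exact (UniqueFactorizationMonoid.dvd_iff_normalizedFactors_le_normalizedFactors hd0 ha).1 hd
  have hinj : Set.InjOn UniqueFactorizationMonoid.normalizedFactors
      {𝔡 : Ideal (𝓞 K) | 𝔡 ∣ 𝔞} := by
    intro 𝔡 hd 𝔢 he hde
    have hd0 : 𝔡 ≠ 0 := fun h0 => ha (zero_dvd_iff.1 (h0 ▸ hd))
    have he0 : 𝔢 ≠ 0 := fun h0 => ha (zero_dvd_iff.1 (h0 ▸ he))
    exact associated_iff_eq.1
      ((UniqueFactorizationMonoid.associated_iff_normalizedFactors_eq_normalizedFactors hd0 he0).2 hde)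
  have hfin : {𝔡 : Ideal (𝓞 K) | 𝔡 ∣ 𝔞}.Finite :=
    Set.Finite.of_injOn hmaps hinj (Finset.finite_toSet _)
  refine ⟨hfin, ?_⟩
  have h1 : {𝔡 : Ideal (𝓞 K) | 𝔡 ∣ 𝔞}.ncard ≤ (Finset.Iic F).card := by
    rw [← Set.ncard_coe_finset]
    exact Set.ncard_le_ncard_of_injOn _ hmaps hinj (Finset.finite_toSet _)
  rw [Multiset.card_Iic] at h1
  have hN : (Ideal.absNorm 𝔞 : ℝ) = ∏ p ∈ F.toFinset, (Ideal.absNorm p : ℝ) ^ F.count p := by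
    conv_lhs => rw [← associated_iff_eq.1 (UniqueFactorizationMonoid.prod_normalizedFactors ha)]
    rw [Finset.prod_multiset_count, map_prod]
    push_cast
    simp [hF]
  have hprime : ∀ p ∈ F.toFinset, 2 ≤ Ideal.absNorm p := by
    intro p hp
    have hp' := UniqueFactorizationMonoid.prime_of_normalized_factor p (Multiset.mem_toFinset.1 hp)
    have h0 : Ideal.absNorm p ≠ 0 := fun h => hp'.ne_zero (Ideal.absNorm_eq_zero_iff.1 h)
    have h1 : Ideal.absNorm p ≠ 1 := fun h => hp'.not_isUnit (by
      rw [Ideal.absNorm_eq_one_iff.1 h]; exact Ideal.isUnit_iff.2 rfl)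
    omega
  have hlocal : ∀ p ∈ F.toFinset, ((F.count p + 1 : ℕ) : ℝ)
      ≤ (if p ∈ S then c else 1) * ((Ideal.absNorm p : ℝ) ^ F.count p) ^ δ := by
    intro p hp
    have h2 : (2 : ℝ) ≤ Ideal.absNorm p := by exact_mod_cast hprime p hp
    set e := F.count p
    have hcomm : ((Ideal.absNorm p : ℝ) ^ e) ^ δ = ((Ideal.absNorm p : ℝ) ^ δ) ^ e := by
      rw [← Real.rpow_natCast, ← Real.rpow_natCast, ← Real.rpow_mul (by positivity),
        ← Real.rpow_mul (by positivity), mul_comm]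
    rw [hcomm]
    push_cast
    split_ifs with hpS
    · have h3 : 1 + δ * Real.log 2 ≤ (Ideal.absNorm p : ℝ) ^ δ := by
        calc 1 + δ * Real.log 2 ≤ Real.exp (Real.log 2 * δ) := by
              linarith [Real.add_one_le_exp (Real.log 2 * δ)]
          _ = 2 ^ δ := (Real.rpow_def_of_pos two_pos δ).symm
          _ ≤ _ := Real.rpow_le_rpow two_pos.le h2 hδ.le
      have h4 : 1 + e * (δ * Real.log 2) ≤ ((Ideal.absNorm p : ℝ) ^ δ) ^ e := by
        refine (one_add_mul_le_pow (by nlinarith [mul_pos hδ hlog]) e).trans ?_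
        gcongr
      have h5 : (e : ℝ) + 1 ≤ c * (1 + e * (δ * Real.log 2)) := by
        have h6 : c * (1 + e * (δ * Real.log 2)) = 1 + 1 / (δ * Real.log 2) + e
            + e * (δ * Real.log 2) := by
          rw [hc]
          field_simp
          ring
        rw [h6]
        have h7 : 0 ≤ 1 / (δ * Real.log 2) := by positivity
        have h8 : 0 ≤ e * (δ * Real.log 2) := by positivity
        linarith
      exact h5.trans (by gcongr)
    · rw [one_mul]
      have h3 : (2 : ℝ) ^ (1 / δ) ≤ Ideal.absNorm p := by
        by_contra! hlt
        refine hpS ((Set.Finite.mem_toFinset _).2 ?_)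
        show Ideal.absNorm p ≤ _
        have := hlt.le.trans (Nat.le_ceil _)
        exact_mod_cast this
      have h4 : (2 : ℝ) ≤ (Ideal.absNorm p : ℝ) ^ δ := by
        calc (2 : ℝ) = ((2 : ℝ) ^ (1 / δ)) ^ δ := by
              rw [← Real.rpow_mul two_pos.le, one_div, inv_mul_cancel₀ hδ.ne', Real.rpow_one]
          _ ≤ _ := Real.rpow_le_rpow (by positivity) h3 hδ.le
      calc (e : ℝ) + 1 ≤ 2 ^ e := by exact_mod_cast Nat.lt_two_pow_self
        _ ≤ _ := by gcongr
  calc ({𝔡 : Ideal (𝓞 K) | 𝔡 ∣ 𝔞}.ncard : ℝ)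
      ≤ ∏ p ∈ F.toFinset, ((F.count p + 1 : ℕ) : ℝ) := by
        rw [← Nat.cast_prod]
        exact_mod_cast h1
    _ ≤ ∏ p ∈ F.toFinset, (if p ∈ S then c else 1) * ((Ideal.absNorm p : ℝ) ^ F.count p) ^ δ :=
        Finset.prod_le_prod (fun _ _ => by positivity) hlocal
    _ = (∏ p ∈ F.toFinset, if p ∈ S then c else 1) * (Ideal.absNorm 𝔞 : ℝ) ^ δ := by
        rw [Finset.prod_mul_distrib, hN, Real.finsetProd_rpow _ _ fun _ _ => by positivity]
    _ ≤ c ^ S.card * (Ideal.absNorm 𝔞 : ℝ) ^ δ := by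
        gcongr
        rw [← Finset.prod_filter, Finset.prod_const]
        exact pow_le_pow_right₀ hc1
          (Finset.card_le_card fun p hp => (Finset.mem_filter.1 hp).2)

end IncompleteNorm

/-! ### Averaging inverse powers of the shortest vectors. -/

namespace IncompleteNorm

open MeasureTheory

theorem pow_sub_pow_le_mul {a b : ℝ} (hb : 0 ≤ b) (hab : b ≤ a) (m : ℕ) :
    a ^ m - b ^ m ≤ m * (a - b) * a ^ (m - 1) := by
  induction m with
  | zero => simp
  | succ m ih =>
    have ha : 0 ≤ a := hb.trans hab
    have h1 : a ^ (m + 1) - b ^ (m + 1) = a ^ m * (a - b) + b * (a ^ m - b ^ m) := by ring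
    have h2 : b * (a ^ m - b ^ m) ≤ a * (m * (a - b) * a ^ (m - 1)) :=
      mul_le_mul hab ih (sub_nonneg.2 (pow_le_pow_left₀ hb hab m)) ha
    have h3 : a * (m * (a - b) * a ^ (m - 1)) = m * (a - b) * a ^ m := by
      rcases m with _ | m
      · simp
      · simp only [Nat.add_sub_cancel]
        ring
    rw [h1]
    simp only [Nat.add_sub_cancel]
    push_cast
    linarith

theorem supAbs_le_iff {m : ℕ} {x : Fin m → ℤ} {r : ℕ} :
    supAbs x ≤ r ↔ x ∈ Finset.Icc (fun _ : Fin m => -(r : ℤ)) (fun _ => (r : ℤ)) := by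
  rw [supAbs, Finset.sup_le_iff, Finset.mem_Icc, Pi.le_def, Pi.le_def, ← forall_and]
  refine ⟨fun h i => ?_, fun h i _ => ?_⟩
  · have := h i (Finset.mem_univ i)
    constructor <;> omega
  · have := h i
    omega

theorem card_Icc_neg (m r : ℕ) :
    (Finset.Icc (fun _ : Fin m => -(r : ℤ)) (fun _ => (r : ℤ))).card = (2 * r + 1) ^ m := by
  rw [Pi.card_Icc]
  simp only [Int.card_Icc, Finset.prod_const, Finset.card_univ, Fintype.card_fin]
  congr 1
  omega

theorem finite_supAbs_eq (m r : ℕ) : {x : Fin m → ℤ | supAbs x = r}.Finite :=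
  (Finset.finite_toSet (Finset.Icc (fun _ : Fin m => -(r : ℤ)) (fun _ => (r : ℤ)))).subset
    fun _ hx => supAbs_le_iff.1 (le_of_eq hx)

/-- The number of integer points on a sphere of the supremum norm. -/
theorem card_supAbs_eq_le (m : ℕ) {r : ℕ} (hr : 0 < r) :
    ((finite_supAbs_eq m r).toFinset.card : ℝ) ≤ 2 * m * 3 ^ (m - 1) * (r : ℝ) ^ (m - 1) := by
  set B := fun r : ℕ => Finset.Icc (fun _ : Fin m => -(r : ℤ)) (fun _ => (r : ℤ)) with hB
  -- The sphere is a difference of two cubes, with `(2r + 1)ᵐ` and `(2r - 1)ᵐ` points.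
  have hsub : (finite_supAbs_eq m r).toFinset ⊆ B r \ B (r - 1) := by
    intro x hx
    have hx' : supAbs x = r := (finite_supAbs_eq m r).mem_toFinset.1 hx
    rw [Finset.mem_sdiff, ← supAbs_le_iff, ← supAbs_le_iff, hx']
    omega
  have hBB : B (r - 1) ⊆ B r := fun x hx => by
    rw [← supAbs_le_iff] at hx ⊢
    omega
  have h1 := Finset.card_le_card hsub
  rw [Finset.card_sdiff_of_subset hBB, card_Icc_neg, card_Icc_neg] at h1
  have h2 : ((finite_supAbs_eq m r).toFinset.card : ℝ)
      ≤ (2 * r + 1 : ℝ) ^ m - (2 * r - 1 : ℝ) ^ m := by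
    have h3 : ((finite_supAbs_eq m r).toFinset.card : ℝ)
        ≤ (((2 * r + 1) ^ m - (2 * (r - 1) + 1) ^ m : ℕ) : ℝ) := by exact_mod_cast h1
    rw [Nat.cast_sub (Nat.pow_le_pow_left (by omega) m)] at h3
    push_cast [Nat.cast_sub (show 1 ≤ r from hr)] at h3
    convert h3 using 3
    ring
  have hr1 : (1 : ℝ) ≤ r := by exact_mod_cast hr
  refine h2.trans ((pow_sub_pow_le_mul (by linarith) (by linarith) m).trans ?_)
  rw [mul_assoc _ (3 ^ (m - 1)), ← mul_pow, show (2 * (r : ℝ) + 1 - (2 * r - 1)) = 2 by ring]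
  rw [mul_comm (m : ℝ) 2]
  gcongr
  linarith

theorem elt_ne_zero {K : Type*} [Field K] {m : ℕ} {α : 𝓞 K} (hinj : Function.Injective (elt α : (Fin m → ℤ) → 𝓞 K))
    {x : Fin m → ℤ} (hx : x ≠ 0) : elt α x ≠ 0 := fun h => hx (hinj (by
  rw [h]; exact (map_zero (eltHom m α)).symm))

variable {K : Type*} [Field K] [NumberField K]

/-- A constant controlling the conjugates of `∑ x_i α^{i-1}`. -/
theorem exists_embedding_bound (m : ℕ) (α : 𝓞 K) : ∃ M : ℝ, 1 ≤ M ∧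
    ∀ (σ : K →+* ℂ) (t : Fin m → ℝ) (B : ℝ), (∀ i, |t i| ≤ B) → 0 ≤ B →
      ‖∑ i, (t i : ℂ) * σ (α : K) ^ (i : ℕ)‖ ≤ B * M := by
  refine ⟨1 + ∑ σ : K →+* ℂ, ∑ i : Fin m, ‖σ (α : K)‖ ^ (i : ℕ), ?_, ?_⟩
  · have : 0 ≤ ∑ σ : K →+* ℂ, ∑ i : Fin m, ‖σ (α : K)‖ ^ (i : ℕ) := by positivity
    linarith
  · intro σ t B ht hB
    calc ‖∑ i, (t i : ℂ) * σ (α : K) ^ (i : ℕ)‖ ≤ ∑ i, ‖(t i : ℂ) * σ (α : K) ^ (i : ℕ)‖ :=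
          norm_sum_le _ _
      _ ≤ ∑ i : Fin m, B * ‖σ (α : K)‖ ^ (i : ℕ) := by
          refine Finset.sum_le_sum fun i _ => ?_
          rw [norm_mul, norm_pow, Complex.norm_real, Real.norm_eq_abs]
          gcongr
          exact ht i
      _ = B * ∑ i : Fin m, ‖σ (α : K)‖ ^ (i : ℕ) := by rw [Finset.mul_sum]
      _ ≤ _ := by
          gcongr
          have := Finset.single_le_sum (f := fun σ : K →+* ℂ => ∑ i : Fin m, ‖σ (α : K)‖ ^ (i : ℕ))
            (fun _ _ => by positivity) (Finset.mem_univ σ)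
          linarith

theorem absNorm_span_elt {m : ℕ} (α : 𝓞 K) (x : Fin m → ℤ) :
    (Ideal.absNorm (Ideal.span {elt α x}) : ℝ) = ‖normForm α fun i => (x i : ℝ)‖ := by
  rw [normForm_intCast, Ideal.absNorm_span_singleton, ← Algebra.coe_norm_int, Nat.cast_natAbs]
  simp

/-- The norm is a form of degree `n = [K : ℚ]` in `x`, so the divisor bound with exponent `δ / n`
yields `supAbs x ^ δ`. -/
theorem exists_ncard_divisors_elt_le {m : ℕ} (α : 𝓞 K)
    (hinj : Function.Injective (elt α : (Fin m → ℤ) → 𝓞 K)) (δ : ℝ) (hδ : 0 < δ) :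
    ∃ C : ℝ, 0 ≤ C ∧ ∀ x : Fin m → ℤ, x ≠ 0 →
      {𝔡 : Ideal (𝓞 K) | elt α x ∈ 𝔡}.Finite ∧
      ({𝔡 : Ideal (𝓞 K) | elt α x ∈ 𝔡}.ncard : ℝ) ≤ C * (supAbs x : ℝ) ^ δ := by
  obtain ⟨M, hM1, hM⟩ := exists_embedding_bound m α
  set n := Fintype.card (K →+* ℂ) with hn
  have hn0 : 0 < n := by
    rw [hn, NumberField.Embeddings.card]
    exact Module.finrank_pos
  have hn0' : (0 : ℝ) < n := by exact_mod_cast hn0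
  obtain ⟨C, hC, H⟩ := exists_ncard_divisors_le K (δ / n) (by positivity)
  refine ⟨C * M ^ δ, by positivity, fun x hx => ?_⟩
  have h0 : Ideal.span {elt α x} ≠ ⊥ := by
    rw [Ne, Ideal.span_singleton_eq_bot]
    exact elt_ne_zero hinj hx
  obtain ⟨h1, h2⟩ := H _ h0
  simp only [Ideal.dvd_span_singleton] at h1 h2
  refine ⟨h1, h2.trans ?_⟩
  rw [mul_assoc]
  refine mul_le_mul_of_nonneg_left ?_ hC
  have h3 : (Ideal.absNorm (Ideal.span {elt α x}) : ℝ) ≤ (supAbs x * M) ^ n := by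
    rw [absNorm_span_elt, normForm, norm_prod]
    refine (Finset.prod_le_prod (fun _ _ => norm_nonneg _) fun σ _ =>
      hM σ _ (supAbs x) (fun i => ?_) (by positivity)).trans ?_
    · rw [← Int.cast_abs, ← Nat.cast_natAbs]
      exact_mod_cast natAbs_le_supAbs x i
    · rw [Finset.prod_const, Finset.card_univ]
  calc _ ≤ ((supAbs x * M) ^ n) ^ (δ / n) := Real.rpow_le_rpow (by positivity) h3 (by positivity)
    _ = (supAbs x * M) ^ δ := by
      rw [← Real.rpow_natCast, ← Real.rpow_mul (by positivity), mul_div_cancel₀ _ hn0'.ne']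
    _ = M ^ δ * (supAbs x : ℝ) ^ δ := by
      rw [Real.mul_rpow (by positivity) (by positivity), mul_comm]

/-- Summation of the inverse powers of the shortest vectors. -/
theorem exists_sum_minAbs_le {m : ℕ} (hm : 0 < m) (α : 𝓞 K)
    (hinj : Function.Injective (elt α : (Fin m → ℤ) → 𝓞 K)) (ε : ℝ) (hε : 0 < ε) :
    ∃ C : ℝ, 0 ≤ C ∧ ∀ (D : ℝ) (Q : ℕ), 0 < D →
      ∑ 𝔡 ∈ idealsBetween K D Q, ((minAbs (coeffLattice m α 𝔡) : ℝ) ^ (m - 1))⁻¹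
        ≤ C * D ^ (1 / (m : ℝ) + ε) := by
  classical
  have hm' : (0 : ℝ) < m := by exact_mod_cast hm
  -- Chosen so that `T * T ^ δ = (2 * D) ^ (1 / m + ε)`.
  set δ := m * ε with hδ
  have hδ0 : 0 < δ := by positivity
  obtain ⟨C, hC, H⟩ := exists_ncard_divisors_elt_le α hinj δ hδ0
  set C' := 2 * m * 3 ^ (m - 1) * C with hC'
  refine ⟨C' * 2 ^ (1 / (m : ℝ) + ε), by positivity, fun D Q hD => ?_⟩
  set P := idealsBetween K D Q
  have hPN : ∀ 𝔡 ∈ P, (Ideal.absNorm 𝔡 : ℝ) ≤ 2 * D ∧ Ideal.absNorm 𝔡 ≠ 0 := fun 𝔡 hd => by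
    have := (Set.Finite.mem_toFinset _).1 hd
    refine ⟨this.2.1, fun h0 => ?_⟩
    have h1 := this.1
    rw [h0, Nat.cast_zero] at h1
    linarith
  set T : ℝ := (2 * D) ^ (1 / (m : ℝ)) with hT
  have hT0 : 0 ≤ T := by positivity
  set l : Ideal (𝓞 K) → ℕ := fun 𝔡 => minAbs (coeffLattice m α 𝔡) with hl
  have hlT : ∀ 𝔡 ∈ P, l 𝔡 ∈ Finset.Icc 1 ⌊T⌋₊ := fun 𝔡 hd => by
    have h1 := minAbs_coeffLattice_pow_le (m := m) (α := α) (hPN 𝔡 hd).2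
    have h2 : ((l 𝔡 : ℝ)) ^ m ≤ 2 * D := le_trans (by exact_mod_cast h1) (hPN 𝔡 hd).1
    rw [Finset.mem_Icc]
    refine ⟨minAbs_pos hm (index_coeffLattice_ne_zero (hPN 𝔡 hd).2), Nat.le_floor ?_⟩
    rw [hT, one_div]
    refine (Real.le_rpow_inv_iff_of_pos (by positivity) (by positivity) hm').2 ?_
    rwa [Real.rpow_natCast]
  have hfib : ∀ r ∈ Finset.Icc 1 ⌊T⌋₊, ∑ 𝔡 ∈ P with l 𝔡 = r, ((l 𝔡 : ℝ) ^ (m - 1))⁻¹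
      ≤ C' * T ^ δ := by
    intro r hr
    rw [Finset.mem_Icc] at hr
    have hr0 : (0 : ℝ) < r := by exact_mod_cast hr.1
    have hrT : (r : ℝ) ≤ T := (Nat.le_floor_iff hT0).1 hr.2
    set S := (finite_supAbs_eq m r).toFinset with hS
    have hS' : ∀ x ∈ S, supAbs x = r ∧ x ≠ 0 := fun x hx => by
      have h1 : supAbs x = r := (finite_supAbs_eq m r).mem_toFinset.1 hx
      refine ⟨h1, ?_⟩
      rintro rfl
      rw [supAbs_eq_zero.2 rfl] at h1
      omega
    set V : (Fin m → ℤ) → Finset (Ideal (𝓞 K)) := fun x =>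
      P.filter fun 𝔡 => elt α x ∈ 𝔡 with hV
    -- Each ideal is charged to a shortest vector of its lattice.
    have hsub : (P.filter fun 𝔡 => l 𝔡 = r) ⊆ S.biUnion V := by
      intro 𝔡 hd
      rw [Finset.mem_filter] at hd
      obtain ⟨x, hx, hx0, hxs⟩ := exists_supAbs_eq_minAbs hm
        (index_coeffLattice_ne_zero (m := m) (α := α) (hPN 𝔡 hd.1).2)
      refine Finset.mem_biUnion.2 ⟨x, (Set.Finite.mem_toFinset _).2 (hxs.trans hd.2), ?_⟩
      exact Finset.mem_filter.2 ⟨hd.1, hx⟩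
    have hVc : ∀ x ∈ S, ((V x).card : ℝ) ≤ C * (r : ℝ) ^ δ := by
      intro x hx
      obtain ⟨h1, h2⟩ := H x (hS' x hx).2
      rw [(hS' x hx).1] at h2
      refine le_trans ?_ h2
      rw [← Set.ncard_coe_finset, Nat.cast_le]
      exact Set.ncard_le_ncard (fun 𝔡 hd => (Finset.mem_filter.1 hd).2) h1
    have hcard : ((P.filter fun 𝔡 => l 𝔡 = r).card : ℝ)
        ≤ 2 * m * 3 ^ (m - 1) * (r : ℝ) ^ (m - 1) * (C * (r : ℝ) ^ δ) := by
      calc ((P.filter fun 𝔡 => l 𝔡 = r).card : ℝ) ≤ ∑ x ∈ S, ((V x).card : ℝ) := by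
            exact_mod_cast (Finset.card_le_card hsub).trans Finset.card_biUnion_le
        _ ≤ S.card • (C * (r : ℝ) ^ δ) := Finset.sum_le_card_nsmul _ _ _ hVc
        _ = S.card * (C * (r : ℝ) ^ δ) := nsmul_eq_mul _ _
        _ ≤ _ := by
            gcongr
            exact card_supAbs_eq_le m hr.1
    have heq : ∑ 𝔡 ∈ P with l 𝔡 = r, ((l 𝔡 : ℝ) ^ (m - 1))⁻¹
        = (P.filter fun 𝔡 => l 𝔡 = r).card * ((r : ℝ) ^ (m - 1))⁻¹ := by
      rw [← nsmul_eq_mul, ← Finset.sum_const]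
      exact Finset.sum_congr rfl fun 𝔡 hd => by rw [(Finset.mem_filter.1 hd).2]
    rw [heq]
    calc _ ≤ 2 * m * 3 ^ (m - 1) * (r : ℝ) ^ (m - 1) * (C * (r : ℝ) ^ δ) * ((r : ℝ) ^ (m - 1))⁻¹ := by
          gcongr
      _ = C' * (r : ℝ) ^ δ := by
          rw [hC']
          field_simp
      _ ≤ C' * T ^ δ := by gcongr
  rw [← Finset.sum_fiberwise_of_maps_to hlT]
  calc _ ≤ (Finset.Icc 1 ⌊T⌋₊).card • (C' * T ^ δ) := Finset.sum_le_card_nsmul _ _ _ hfib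
    _ = ⌊T⌋₊ * (C' * T ^ δ) := by rw [nsmul_eq_mul, Nat.card_Icc, Nat.add_sub_cancel]
    _ ≤ T * (C' * T ^ δ) := by
      gcongr
      exact Nat.floor_le hT0
    _ = C' * (T * T ^ δ) := by ring
    _ = C' * 2 ^ (1 / (m : ℝ) + ε) * D ^ (1 / (m : ℝ) + ε) := by
      rw [mul_assoc C', ← Real.mul_rpow two_pos.le hD.le, Real.rpow_add (by positivity), hT, hδ,
        ← Real.rpow_mul (by positivity), ← mul_assoc (1 / (m : ℝ)), one_div_mul_cancel hm'.ne', one_mul]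

end IncompleteNorm

/-! ### Type I sums over elements, and the passage to ideals. -/

namespace IncompleteNorm

open MeasureTheory

theorem multiplesIn_top {K : Type*} [Field K] (C : Set (𝓞 K)) : multiplesIn C ⊤ = C := by
  ext c
  simp [multiplesIn]

variable {K : Type*} [Field K] [NumberField K]

theorem mem_idealsBetween {D : ℝ} {Q : ℕ} {𝔡 : Ideal (𝓞 K)} :
    𝔡 ∈ idealsBetween K D Q ↔ D ≤ (Ideal.absNorm 𝔡 : ℝ) ∧ (Ideal.absNorm 𝔡 : ℝ) ≤ 2 * D ∧
      Nat.Coprime (Ideal.absNorm 𝔡) Q := Set.Finite.mem_toFinset _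

theorem absNorm_ne_zero_of_mem_idealsBetween {D : ℝ} (hD : 0 < D) {Q : ℕ} {𝔡 : Ideal (𝓞 K)}
    (h : 𝔡 ∈ idealsBetween K D Q) : Ideal.absNorm 𝔡 ≠ 0 := fun h0 => by
  have h1 := (mem_idealsBetween.1 h).1
  rw [h0, Nat.cast_zero] at h1
  linarith

/-- The Type I sum over a region, without loss in the modulus. -/
theorem exists_sum_abs_multiplesIn_le {m : ℕ} (hm : 0 < m) (α : 𝓞 K)
    (hinj : Function.Injective (elt α : (Fin m → ℤ) → 𝓞 K)) (h : ℕ) (ε : ℝ) (hε : 0 < ε) :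
    ∃ C : ℝ, 0 ≤ C ∧ ∀ (X : ℝ) (R : Set (Fin m → ℝ)) (x₀ : Fin m → ℤ) (Q : ℕ) (D : ℝ),
      0 ≤ X → MeasurableSet R → R ⊆ Set.Icc (fun _ => -X) (fun _ => X) →
      LinesMeetInIntervals h R → 1 ≤ Q → 0 < D →
      ∑ 𝔡 ∈ idealsBetween K D Q, |((multiplesIn (eltSet α R Q x₀) 𝔡).ncard : ℝ)
          - rho m α 𝔡 / Ideal.absNorm 𝔡 * (volume.real R / (Q : ℝ) ^ m)|
        ≤ C * (X ^ (m - 1) * D ^ (1 / (m : ℝ) + ε) + D) := by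
  obtain ⟨C₁, hC₁, H₁⟩ := exists_abs_ncard_multiplesIn_sub_le (K := K) hm h
  obtain ⟨C₂, hC₂, H₂⟩ := exists_sum_minAbs_le hm α hinj ε hε
  obtain ⟨C₃, hC₃, H₃⟩ := exists_card_idealsBetween_le K
  refine ⟨C₁ * (C₂ + C₃), by positivity, fun X R x₀ Q D hX hRm hRX hRl hQ hD => ?_⟩
  calc _ ≤ ∑ 𝔡 ∈ idealsBetween K D Q,
        C₁ * (1 + X ^ (m - 1) * ((minAbs (coeffLattice m α 𝔡) : ℝ) ^ (m - 1))⁻¹) :=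
        Finset.sum_le_sum fun 𝔡 hd => H₁ α 𝔡 X Q x₀ R hinj
          (absNorm_ne_zero_of_mem_idealsBetween hD hd) (mem_idealsBetween.1 hd).2.2 hQ hX hRm hRX hRl
    _ = C₁ * ((idealsBetween K D Q).card + X ^ (m - 1) *
        ∑ 𝔡 ∈ idealsBetween K D Q, ((minAbs (coeffLattice m α 𝔡) : ℝ) ^ (m - 1))⁻¹) := by
        rw [← Finset.mul_sum, Finset.sum_add_distrib, ← Finset.mul_sum, Finset.sum_const,
          nsmul_eq_mul, mul_one]
    _ ≤ C₁ * (C₃ * D + X ^ (m - 1) * (C₂ * D ^ (1 / (m : ℝ) + ε))) := by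
        gcongr
        · exact H₃ D Q hD
        · exact H₂ D Q hD
    _ ≤ C₁ * (C₂ + C₃) * (X ^ (m - 1) * D ^ (1 / (m : ℝ) + ε) + D) := by
        rw [mul_assoc]
        refine mul_le_mul_of_nonneg_left ?_ hC₁
        have h1 : 0 ≤ C₂ * D := by positivity
        have h2 : 0 ≤ C₃ * (X ^ (m - 1) * D ^ (1 / (m : ℝ) + ε)) := by positivity
        linarith

theorem linesMeetInIntervals_Icc {m : ℕ} (a b : Fin m → ℝ) :
    LinesMeetInIntervals 1 (Set.Icc a b) := by
  intro x v _
  refine ⟨fun _ => {t : ℝ | x + t • v ∈ Set.Icc a b}, fun _ => ?_, (Set.iUnion_const _).symm⟩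
  have : Convex ℝ ((AffineMap.lineMap x (x + v) : ℝ →ᵃ[ℝ] (Fin m → ℝ)) ⁻¹' Set.Icc a b) :=
    (convex_Icc a b).affine_preimage _
  have h2 : (AffineMap.lineMap x (x + v) : ℝ →ᵃ[ℝ] (Fin m → ℝ)) ⁻¹' Set.Icc a b
      = {t : ℝ | x + t • v ∈ Set.Icc a b} := by
    ext t
    simp [AffineMap.lineMap_apply, add_comm]
  exact h2 ▸ this.ordConnected

/-- The density of a congruence class in a region. -/
theorem exists_abs_ncard_eltSet_sub_le {m : ℕ} (hm : 0 < m) (h : ℕ) : ∃ C : ℝ, 0 ≤ C ∧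
    ∀ (α : 𝓞 K) (X : ℝ) (Q : ℕ) (x₀ : Fin m → ℤ) (R : Set (Fin m → ℝ)),
    Function.Injective (elt α : (Fin m → ℤ) → 𝓞 K) → 1 ≤ Q → 1 ≤ X →
    MeasurableSet R → R ⊆ Set.Icc (fun _ => -X) (fun _ => X) → LinesMeetInIntervals h R →
    |((eltSet α R Q x₀).ncard : ℝ) - volume.real R / (Q : ℝ) ^ m| ≤ C * X ^ (m - 1) := by
  obtain ⟨C, hC, H⟩ := exists_abs_ncard_multiplesIn_sub_le (K := K) hm h
  refine ⟨C * 2, by positivity, fun α X Q x₀ R hinj hQ hX hRm hRX hRl => ?_⟩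
  have hN : Ideal.absNorm (⊤ : Ideal (𝓞 K)) ≠ 0 := by simp
  -- The unit ideal imposes no divisibility and has index one, so its count is that of the whole
  -- congruence class.
  have h1 := H α ⊤ X Q x₀ R hinj hN (by simp) hQ (by linarith) hRm hRX hRl
  have h2 : (coeffLattice m α ⊤).index = 1 := by
    have := index_coeffLattice_dvd (m := m) α ⊤
    rw [Ideal.absNorm_top] at this
    exact Nat.dvd_one.1 this
  rw [rho_div_absNorm hm α hN, h2, multiplesIn_top, Nat.cast_one, inv_one, one_mul] at h1
  refine h1.trans ?_
  rw [mul_assoc]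
  refine mul_le_mul_of_nonneg_left ?_ hC
  have h3 : (1 : ℝ) ≤ minAbs (coeffLattice m α ⊤) := by
    exact_mod_cast minAbs_pos hm (index_coeffLattice_ne_zero (α := α) hN)
  have h4 : ((minAbs (coeffLattice m α ⊤) : ℝ) ^ (m - 1))⁻¹ ≤ 1 :=
    inv_le_one_of_one_le₀ (one_le_pow₀ h3)
  have h5 : 1 ≤ X ^ (m - 1) := one_le_pow₀ hX
  nlinarith

/-- Elements of a short box on which the norm form is large generate distinct ideals. -/
theorem exists_injOn_span_eltSet {m : ℕ} (α : 𝓞 K)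
    (hinj : Function.Injective (elt α : (Fin m → ℤ) → 𝓞 K)) {κ : ℝ} (hκ : 0 < κ) :
    ∃ η₀ : ℝ, 0 < η₀ ∧ ∀ (X η : ℝ) (Y : Fin m → ℝ) (q : ℕ) (a₀ : Fin m → ℤ), 0 < X → 0 ≤ η →
      η < η₀ → (∀ i, 0 ≤ Y i ∧ Y i ≤ X) → κ * X ^ Module.finrank ℚ K ≤ ‖normForm α Y‖ →
      Set.InjOn (fun c : 𝓞 K => Ideal.span {c})
        (eltSet α (Set.Icc Y fun i => Y i + η * Y i) q a₀) := by
  classical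
  obtain ⟨M, hM1, hM⟩ := exists_embedding_bound m α
  set n := Module.finrank ℚ K with hn
  have hn0 : 0 < n := Module.finrank_pos
  refine ⟨κ / (2 * M ^ n), by positivity, ?_⟩
  rintro X η Y q a₀ hX hη hη₀ hY hnorm _ ⟨x, hx, -, rfl⟩ _ ⟨y, hy, -, rfl⟩ hspan
  have hM0 : 0 < M := by linarith
  -- A product of `n` factors, each at most `X * M`, is at least `κ * X ^ n`, so no single factor
  -- can be small.
  have hYσ : ∀ σ : K →+* ℂ, κ * X / M ^ (n - 1) ≤ ‖∑ i, (Y i : ℂ) * σ (α : K) ^ (i : ℕ)‖ := by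
    intro σ
    rw [normForm, norm_prod, ← Finset.mul_prod_erase _ _ (Finset.mem_univ σ)] at hnorm
    have h1 : ∏ τ ∈ Finset.univ.erase σ, ‖∑ i, (Y i : ℂ) * τ (α : K) ^ (i : ℕ)‖
        ≤ (X * M) ^ (n - 1) := by
      refine (Finset.prod_le_prod (fun _ _ => norm_nonneg _) fun τ _ =>
        hM τ Y X (fun i => ?_) hX.le).trans ?_
      · rw [abs_of_nonneg (hY i).1]
        exact (hY i).2
      · rw [Finset.prod_const, Finset.card_erase_of_mem (Finset.mem_univ σ), Finset.card_univ,
          NumberField.Embeddings.card]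
    have h2 := hnorm.trans (mul_le_mul_of_nonneg_left h1 (norm_nonneg _))
    rw [div_le_iff₀ (by positivity)]
    rw [mul_pow] at h2
    have h3 : X ^ n = X * X ^ (n - 1) := by
      rw [← pow_succ', Nat.sub_add_cancel hn0]
    rw [h3] at h2
    have h4 : 0 < X ^ (n - 1) := by positivity
    refine le_of_mul_le_mul_right ?_ h4
    linarith
  have hdiff : ∀ (σ : K →+* ℂ) (u v : Fin m → ℝ), (∀ i, |u i - v i| ≤ η * X) →
      ‖(∑ i, (u i : ℂ) * σ (α : K) ^ (i : ℕ)) - ∑ i, (v i : ℂ) * σ (α : K) ^ (i : ℕ)‖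
        ≤ η * X * M := by
    intro σ u v huv
    have := hM σ (fun i => u i - v i) (η * X) huv (by positivity)
    rw [← Finset.sum_sub_distrib]
    simpa only [Complex.ofReal_sub, sub_mul] using this
  have hηY : ∀ i, η * Y i ≤ η * X := fun i => mul_le_mul_of_nonneg_left (hY i).2 hη
  -- Conjugates vary by at most `η * X * M` over the box, and `η < κ / (2 * M ^ n)` makes twice this
  -- less than the lower bound at `Y`. So every conjugate of the difference is smaller than that of
  -- `y`.
  have hsmall : ∀ σ : K →+* ℂ, ‖∑ i, (((x - y) i : ℤ) : ℝ) * σ (α : K) ^ (i : ℕ)‖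
      < ‖∑ i, (((y i : ℤ) : ℝ) : ℂ) * σ (α : K) ^ (i : ℕ)‖ := by
    intro σ
    have h1 := hdiff σ (fun i => (x i : ℝ)) (fun i => (y i : ℝ)) (fun i => by
      have := hx.1 i
      have := hx.2 i
      have := hy.1 i
      have := hy.2 i
      have := hηY i
      rw [abs_le]
      constructor <;> linarith)
    have h2 := hdiff σ Y (fun i => (y i : ℝ)) (fun i => by
      have := hy.1 i
      have := hy.2 i
      have := hηY i
      rw [abs_le]
      constructor <;> linarith)
    have h3 := hYσ σ
    have h4 := norm_sub_norm_le (∑ i, (Y i : ℂ) * σ (α : K) ^ (i : ℕ))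
      (∑ i, (((y i : ℤ) : ℝ) : ℂ) * σ (α : K) ^ (i : ℕ))
    have h5 : 2 * (η * X * M) < κ * X / M ^ (n - 1) := by
      rw [lt_div_iff₀ (by positivity)] at hη₀ ⊢
      have h6 : M ^ n = M * M ^ (n - 1) := by
        rw [← pow_succ', Nat.sub_add_cancel hn0]
      rw [h6] at hη₀
      have := mul_lt_mul_of_pos_right hη₀ hX
      linarith
    have h7 : ∑ i, ((((x - y) i : ℤ) : ℝ) : ℂ) * σ (α : K) ^ (i : ℕ)
        = (∑ i, (((x i : ℤ) : ℝ) : ℂ) * σ (α : K) ^ (i : ℕ))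
          - ∑ i, (((y i : ℤ) : ℝ) : ℂ) * σ (α : K) ^ (i : ℕ) := by
      rw [← Finset.sum_sub_distrib]
      exact Finset.sum_congr rfl fun i _ => by push_cast [Pi.sub_apply]; ring
    rw [h7]
    linarith
  by_contra hne
  have hxy : x - y ≠ 0 := fun h0 => hne (by rw [sub_eq_zero.1 h0])
  -- If the two ideals agree, the element of `y` divides the nonzero difference, whose norm would
  -- then be at least as large, contrary to `hsmall`.
  have hmem : elt α (x - y) ∈ Ideal.span {elt α y} := by
    have h1 : elt α (x - y) = elt α x - elt α y := map_sub (eltHom m α) x y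
    rw [h1]
    refine Ideal.sub_mem _ ?_ (Ideal.mem_span_singleton_self _)
    have h2 : Ideal.span {elt α x} = Ideal.span {elt α y} := hspan
    rw [← h2]
    exact Ideal.mem_span_singleton_self _
  have hdvd := Ideal.absNorm_dvd_absNorm_of_le ((Ideal.span_singleton_le_iff_mem _).2 hmem)
  have hne0 : Ideal.absNorm (Ideal.span {elt α (x - y)}) ≠ 0 := by
    rw [Ne, Ideal.absNorm_eq_zero_iff, Ideal.span_singleton_eq_bot]
    exact elt_ne_zero hinj hxy
  have hle := Nat.le_of_dvd (Nat.pos_of_ne_zero hne0) hdvd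
  have hle' : (Ideal.absNorm (Ideal.span {elt α y}) : ℝ)
      ≤ Ideal.absNorm (Ideal.span {elt α (x - y)}) := by exact_mod_cast hle
  have hne0' : (Ideal.absNorm (Ideal.span {elt α (x - y)}) : ℝ) ≠ 0 := by exact_mod_cast hne0
  rw [absNorm_span_elt, normForm, norm_prod] at hne0'
  rw [absNorm_span_elt, absNorm_span_elt, normForm, normForm, norm_prod, norm_prod] at hle'
  refine absurd hle' (not_le.2 (Finset.prod_lt_prod_of_nonempty (fun σ hσ => ?_)
    (fun σ _ => hsmall σ) ?_))
  · exact lt_of_le_of_ne (norm_nonneg _) (Ne.symm (Finset.prod_ne_zero_iff.1 hne0' σ hσ))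
  · rw [← Finset.card_pos, Finset.card_univ, NumberField.Embeddings.card]
    exact hn0

/-- If the elements of `S` generate distinct ideals, quotients of ideals count multiples. -/
theorem ncard_quotientsIn_image_span {S : Set (𝓞 K)}
    (hS : Set.InjOn (fun c : 𝓞 K => Ideal.span {c}) S) {𝔡 : Ideal (𝓞 K)} (hd : 𝔡 ≠ ⊥) :
    (quotientsIn ((fun c => Ideal.span {c}) '' S) 𝔡).ncard = (multiplesIn S 𝔡).ncard := by
  have h1 : (fun 𝔟 => 𝔟 * 𝔡) '' quotientsIn ((fun c => Ideal.span {c}) '' S) 𝔡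
      = (fun c => Ideal.span {c}) '' multiplesIn S 𝔡 := by
    ext I
    constructor
    · rintro ⟨𝔟, ⟨c, hc, hcb⟩, rfl⟩
      refine ⟨c, ⟨hc, ?_⟩, hcb⟩
      exact ⟨𝔟, hcb.trans (mul_comm _ _)⟩
    · rintro ⟨c, ⟨hc, 𝔟, hb⟩, rfl⟩
      exact ⟨𝔟, ⟨c, hc, hb.trans (mul_comm _ _)⟩, (hb.trans (mul_comm _ _)).symm⟩
  rw [← Set.ncard_image_of_injective _ (mul_left_injective₀ (b := 𝔡) hd), h1,
    (hS.mono fun c hc => hc.1).ncard_image]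

/-- The minimal polynomial of a root of an irreducible binomial. -/
theorem minpoly_of_pow_eq {n : ℕ} (hn : 0 < n) {θ : ℤ}
    (hθ : Irreducible (Polynomial.X ^ n - Polynomial.C θ : Polynomial ℤ)) {α : 𝓞 K}
    (hα : α ^ n = (θ : 𝓞 K)) :
    minpoly ℚ (α : K) = Polynomial.X ^ n - Polynomial.C (θ : ℚ) := by
  have hmonic : (Polynomial.X ^ n - Polynomial.C θ : Polynomial ℤ).Monic :=
    Polynomial.monic_X_pow_sub_C θ hn.ne'
  have h1 := (Polynomial.IsPrimitive.Int.irreducible_iff_irreducible_map_cast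
    hmonic.isPrimitive).1 hθ
  have h2 : (Polynomial.X ^ n - Polynomial.C θ : Polynomial ℤ).map (Int.castRingHom ℚ)
      = Polynomial.X ^ n - Polynomial.C (θ : ℚ) := by simp
  rw [h2] at h1
  refine (minpoly.eq_of_irreducible_of_monic h1 ?_ (Polynomial.monic_X_pow_sub_C _ hn.ne')).symm
  have h3 := congrArg (algebraMap (𝓞 K) K) hα
  rw [map_pow, map_intCast] at h3
  simp [h3]

/-- The minimal polynomial of `α` has degree `n ≥ m`, so `1, α, …, α^{m-1}` are linearly
independent. -/
theorem elt_injective {m n : ℕ} (hn : 0 < n) (hmn : m ≤ n) {θ : ℤ}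
    (hθ : Irreducible (Polynomial.X ^ n - Polynomial.C θ : Polynomial ℤ)) {α : 𝓞 K}
    (hα : α ^ n = (θ : 𝓞 K)) : Function.Injective (elt α : (Fin m → ℤ) → 𝓞 K) := by
  have hdeg : (minpoly ℚ (α : K)).natDegree = n := by
    rw [minpoly_of_pow_eq hn hθ hα, Polynomial.natDegree_X_pow_sub_C]
  have hli := (linearIndependent_pow (K := ℚ) (α : K)).comp
    (fun i : Fin m => Fin.castLE (hmn.trans hdeg.ge) i) (Fin.castLE_injective _)
  rw [Fintype.linearIndependent_iff] at hli
  refine (injective_iff_map_eq_zero (eltHom m α)).2 fun x hx => ?_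
  ext i
  have h1 := hli (fun i => (x i : ℚ)) (by
    have h2 : elt α x = 0 := hx
    have h3 := congrArg (fun a : 𝓞 K => (a : K)) h2
    simpa [elt, Algebra.smul_def] using h3) i
  exact_mod_cast h1

theorem finrank_of_pow_eq {n : ℕ} (hn : 0 < n) {θ : ℤ}
    (hθ : Irreducible (Polynomial.X ^ n - Polynomial.C θ : Polynomial ℤ)) {α : 𝓞 K}
    (hα : α ^ n = (θ : 𝓞 K)) (hK : IntermediateField.adjoin ℚ {(α : K)} = ⊤) :
    Module.finrank ℚ K = n := by
  have h1 := IntermediateField.adjoin.finrank (K := ℚ) (x := (α : K))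
    (Algebra.IsIntegral.isIntegral _)
  rw [hK, IntermediateField.finrank_top', minpoly_of_pow_eq hn hθ hα,
    Polynomial.natDegree_X_pow_sub_C] at h1
  exact h1

end IncompleteNorm

/-! ### The Type I sum over ideals and the final estimates. -/

namespace IncompleteNorm

open MeasureTheory

variable {K : Type*} [Field K] [NumberField K]

/-- The Type I sum over the ideals generated by the elements of a short box. -/
theorem exists_sum_abs_quotientsIn_le {m : ℕ} (hm : 0 < m) (α : 𝓞 K)
    (hinj : Function.Injective (elt α : (Fin m → ℤ) → 𝓞 K)) (ε : ℝ) (hε : 0 < ε) :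
    ∃ C : ℝ, 0 ≤ C ∧ ∀ (X η : ℝ) (Y : Fin m → ℝ) (a₀ : Fin m → ℤ) (q : ℕ) (D : ℝ),
      1 ≤ X → 0 ≤ η → η ≤ 1 → (∀ i, 0 ≤ Y i ∧ Y i ≤ X) → 1 ≤ q → 0 < D →
      Set.InjOn (fun c : 𝓞 K => Ideal.span {c})
        (eltSet α (Set.Icc Y fun i => Y i + η * Y i) q a₀) →
      ∑ 𝔡 ∈ idealsBetween K D q, |((quotientsIn (boxIdeals α Y η q a₀) 𝔡).ncard : ℝ)
          - rho m α 𝔡 * ((boxIdeals α Y η q a₀).ncard : ℝ) / (Ideal.absNorm 𝔡 : ℝ)|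
        ≤ C * (X ^ (m - 1) * D ^ (1 / (m : ℝ) + ε) + D) := by
  obtain ⟨C₁, hC₁, H₁⟩ := exists_sum_abs_multiplesIn_le hm α hinj 1 ε hε
  obtain ⟨C₂, hC₂, H₂⟩ := exists_abs_ncard_eltSet_sub_le (K := K) hm 1
  obtain ⟨C₃, hC₃, H₃⟩ := exists_sum_minAbs_le hm α hinj ε hε
  refine ⟨C₁ * 2 ^ (m - 1) + C₂ * 2 ^ (m - 1) * C₃, by positivity, ?_⟩
  intro X η Y a₀ q D hX hη0 hη1 hY hq hD hbox
  set R := Set.Icc Y fun i => Y i + η * Y i with hR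
  have hRX : R ⊆ Set.Icc (fun _ => -(2 * X)) (fun _ => 2 * X) := fun t ht => by
    refine ⟨fun i => ?_, fun i => ?_⟩
    · have := ht.1 i
      have := (hY i).1
      linarith
    · have h1 := ht.2 i
      have h2 := mul_le_mul hη1 (hY i).2 (hY i).1 zero_le_one
      have := (hY i).2
      linarith
  have hRl : LinesMeetInIntervals 1 R := linesMeetInIntervals_Icc _ _
  have e1 := H₁ (2 * X) R a₀ q D (by linarith) measurableSet_Icc hRX hRl hq hD
  have e2 := H₂ α (2 * X) q a₀ R hinj hq (by linarith) measurableSet_Icc hRX hRl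
  have hA : (boxIdeals α Y η q a₀).ncard = (eltSet α R q a₀).ncard := hbox.ncard_image
  set V := volume.real R / (q : ℝ) ^ m
  calc _ ≤ ∑ 𝔡 ∈ idealsBetween K D q, (|((multiplesIn (eltSet α R q a₀) 𝔡).ncard : ℝ)
            - rho m α 𝔡 / Ideal.absNorm 𝔡 * V|
          + C₂ * (2 * X) ^ (m - 1) * ((minAbs (coeffLattice m α 𝔡) : ℝ) ^ (m - 1))⁻¹) := by
        refine Finset.sum_le_sum fun 𝔡 hd => ?_
        have hd0 := absNorm_ne_zero_of_mem_idealsBetween hD hd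
        have hd' : 𝔡 ≠ ⊥ := fun h => hd0 (Ideal.absNorm_eq_zero_iff.2 h)
        have h1 : (quotientsIn (boxIdeals α Y η q a₀) 𝔡).ncard
            = (multiplesIn (eltSet α R q a₀) 𝔡).ncard := ncard_quotientsIn_image_span hbox hd'
        rw [h1, hA]
        have h2 := rho_div_absNorm_nonneg (m := m) α 𝔡
        have h3 := rho_div_absNorm_le hm α hd0
        -- The expected density `V` is inserted between `#𝒜_𝔡` and `#𝒜`. The second difference is
        -- `O(X^{m-1})` and carries the weight `ρ(𝔡)/N(𝔡)`, whose sum is controlled by the same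
        -- average.
        have h4 : ((multiplesIn (eltSet α R q a₀) 𝔡).ncard : ℝ)
            - rho m α 𝔡 * ((eltSet α R q a₀).ncard : ℝ) / Ideal.absNorm 𝔡
            = (((multiplesIn (eltSet α R q a₀) 𝔡).ncard : ℝ) - rho m α 𝔡 / Ideal.absNorm 𝔡 * V)
              - rho m α 𝔡 / Ideal.absNorm 𝔡 * (((eltSet α R q a₀).ncard : ℝ) - V) := by ring
        rw [h4]
        refine (abs_sub _ _).trans ?_
        rw [abs_mul, abs_of_nonneg h2, mul_comm (rho m α 𝔡 / _) |_|]
        have h5 : 0 ≤ C₂ * (2 * X) ^ (m - 1) := by positivity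
        gcongr
    _ ≤ C₁ * ((2 * X) ^ (m - 1) * D ^ (1 / (m : ℝ) + ε) + D)
        + C₂ * (2 * X) ^ (m - 1) * (C₃ * D ^ (1 / (m : ℝ) + ε)) := by
        rw [Finset.sum_add_distrib, ← Finset.mul_sum]
        gcongr
        exact H₃ D q hD
    _ ≤ _ := by
        have h1 : (1 : ℝ) ≤ 2 ^ (m - 1) := one_le_pow₀ one_le_two
        have h2 : C₁ * D ≤ C₁ * 2 ^ (m - 1) * D := by
          gcongr
          exact le_mul_of_one_le_right hC₁ h1
        have h3 : 0 ≤ C₂ * 2 ^ (m - 1) * C₃ * D := by positivity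
        rw [mul_pow]
        linarith

end IncompleteNorm

theorem mainTheorem4 (n k : ℕ) (hk : 0 < k) (hnk : 3 * k < n) (θ : ℤ)
    (hθ : Irreducible (Polynomial.X ^ n - Polynomial.C θ : Polynomial ℤ))
    (K : Type*) [Field K] [NumberField K] (α : 𝓞 K) (hα : α ^ n = (θ : 𝓞 K))
    (hK : IntermediateField.adjoin ℚ {(α : K)} = ⊤) :
    (∀ (h : ℕ) (ε : ℝ), 0 < ε → ∃ C : ℝ, ∀ (X : ℝ) (R : Set (Fin (n - k) → ℝ))
        (x₀ : Fin (n - k) → ℤ) (Q : ℕ) (D : ℝ),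
      1 ≤ X → MeasurableSet R → R ⊆ Set.Icc (fun _ => -X) (fun _ => X) →
      IncompleteNorm.LinesMeetInIntervals h R →
      IncompleteNorm.ContainsCube (X ^ (1 - 1 / (2 * (n : ℝ)))) R →
      1 ≤ Q → (Q : ℝ) ≤ X ^ (1 / 2 : ℝ) → 0 < D →
      ∑ 𝔡 ∈ IncompleteNorm.idealsBetween K D Q,
          |((IncompleteNorm.multiplesIn (IncompleteNorm.eltSet α R Q x₀) 𝔡).ncard : ℝ)
            - IncompleteNorm.rho (n - k) α 𝔡 * MeasureTheory.volume.real R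
                / ((Q : ℝ) ^ (n - k) * (Ideal.absNorm 𝔡 : ℝ))|
        ≤ C * (X ^ (n - k - 1) * (Q : ℝ) ^ ((n : ℝ) + ε) * D ^ (1 / ((n : ℝ) - (k : ℝ)) + ε)
            + D * (Q : ℝ) ^ ((n : ℝ) + ε))) ∧
    (∀ ε : ℝ, 0 < ε → ∃ C : ℝ, ∀ κ : ℝ, 0 < κ → ∃ X₀ : ℝ, ∀ (X : ℝ) (Y : Fin (n - k) → ℝ)
        (a₀ : Fin (n - k) → ℤ) (q : ℕ) (D : ℝ),
      X₀ ≤ X → (∀ i, 0 ≤ Y i ∧ Y i ≤ X) → κ * X ^ n ≤ ‖IncompleteNorm.normForm α Y‖ →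
      1 ≤ q → (q : ℝ) ≤ Real.exp (Real.log X ^ (1 / 4 : ℝ)) → 0 < D →
      ∑ 𝔡 ∈ IncompleteNorm.idealsBetween K D q,
          |((IncompleteNorm.quotientsIn
                (IncompleteNorm.boxIdeals α Y (Real.log X ^ (-100 : ℝ)) q a₀) 𝔡).ncard : ℝ)
            - IncompleteNorm.rho (n - k) α 𝔡
                * ((IncompleteNorm.boxIdeals α Y (Real.log X ^ (-100 : ℝ)) q a₀).ncard : ℝ)
                / (Ideal.absNorm 𝔡 : ℝ)|
        ≤ C * (X ^ ((n : ℝ) - (k : ℝ) - 1 + ε) * D ^ (1 / ((n : ℝ) - (k : ℝ)) + ε)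
            + D * X ^ ε)) := by
  have hn : 0 < n := by omega
  have hm : 0 < n - k := by omega
  have hinj := IncompleteNorm.elt_injective (m := n - k) hn (Nat.sub_le n k) hθ hα
  have hcast : ((n - k : ℕ) : ℝ) = (n : ℝ) - k := Nat.cast_sub (by omega)
  constructor
  · intro h ε hε
    obtain ⟨C, hC, H⟩ := IncompleteNorm.exists_sum_abs_multiplesIn_le hm α hinj h ε hε
    refine ⟨C, fun X R x₀ Q D hX hRm hRX hRl _ hQ _ hD => ?_⟩
    have h1 := H X R x₀ Q D (by linarith) hRm hRX hRl hQ hD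
    rw [hcast] at h1
    -- The bound obtained has no loss in `Q`; the power of `Q` is inserted as a factor at least one.
    have hQ1 : 1 ≤ (Q : ℝ) ^ ((n : ℝ) + ε) :=
      Real.one_le_rpow (by exact_mod_cast hQ) (by positivity)
    calc _ = _ := Finset.sum_congr rfl fun 𝔡 _ => by
          rw [div_mul_div_comm, mul_comm ((Q : ℝ) ^ (n - k))]
      _ ≤ _ := h1
      _ ≤ _ := by
          refine mul_le_mul_of_nonneg_left (add_le_add ?_ (le_mul_of_one_le_right hD.le hQ1)) hC
          refine mul_le_mul_of_nonneg_right (le_mul_of_one_le_right (by positivity) hQ1) ?_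
          positivity
  · intro ε hε
    obtain ⟨C, hC, H⟩ := IncompleteNorm.exists_sum_abs_quotientsIn_le hm α hinj ε hε
    refine ⟨C, fun κ hκ => ?_⟩
    obtain ⟨η₀, hη₀, Hη⟩ := IncompleteNorm.exists_injOn_span_eltSet α hinj hκ
    rw [IncompleteNorm.finrank_of_pow_eq hn hθ hα hK] at Hη
    -- Only the injectivity threshold `η₀` depends on `κ`. Since `η₁ → 0`, this is absorbed into
    -- `X₀`, and `C` stays independent of `κ`.
    have hlim : Filter.Tendsto (fun X : ℝ => Real.log X ^ (-100 : ℝ)) Filter.atTop (nhds 0) :=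
      (tendsto_rpow_neg_atTop (by norm_num)).comp Real.tendsto_log_atTop
    obtain ⟨X₀, hX₀⟩ := Filter.eventually_atTop.1
      (hlim.eventually (gt_mem_nhds (lt_min hη₀ one_pos)))
    refine ⟨max X₀ 1, fun X Y a₀ q D hX hY hnorm hq _ hD => ?_⟩
    have hX1 : 1 ≤ X := (le_max_right _ _).trans hX
    have hη := hX₀ X ((le_max_left _ _).trans hX)
    have hη0 : 0 ≤ Real.log X ^ (-100 : ℝ) := Real.rpow_nonneg (Real.log_nonneg hX1) _
    refine (H X _ Y a₀ q D hX1 hη0 (hη.le.trans (min_le_right _ _)) hY hq hD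
      (Hη X _ Y q a₀ (by linarith) hη0 (hη.trans_le (min_le_left _ _)) hY hnorm)).trans ?_
    have hXε : 1 ≤ X ^ ε := Real.one_le_rpow hX1 hε.le
    have hXpow : X ^ (n - k - 1) ≤ X ^ ((n : ℝ) - k - 1 + ε) := by
      rw [← Real.rpow_natCast, Nat.cast_sub hm, hcast, Nat.cast_one]
      exact Real.rpow_le_rpow_of_exponent_le hX1 (by linarith)
    rw [hcast]
    refine mul_le_mul_of_nonneg_left (add_le_add ?_ (le_mul_of_one_le_right hD.le hXε)) hC
    exact mul_le_mul_of_nonneg_right hXpow (by positivity)
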